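/- **Theorem (asymptotic normality).** Let $d\ge 1$, $\|x\|_1=\sum_{i=1}^d|x_i|$, $\mathcal S=\{x\in[0,1]^d:\|x\|_1\le 1\}$ and $\mathrm{Int}(\mathcal S)=\{x\in(0,1)^d:\|x\|_1<1\}$. Let $X_1,X_2,\dots$ be i.i.d. random vectors with density $f$ supported on $\mathcal S$. For $k\in\mathbb N_0^d$ with $\|k\|_1\le r$ put $$P_{k,r}(x)=\frac{r!}{(r-\|k\|_1)!\,\prod_{i=1}^d k_i!}\,(1-\|x\|_1)^{r-\|k\|_1}\prod_{i=1}^d x_i^{k_i},$$ and for $n,m\in\mathbb N$ define the Bernstein density estimator $$\hat f_{n,m}(x)=\sum_{k\in\mathbb N_0^d,\ \|k\|_1\le m-1} c_m\Big\{\frac1n\sum_{i=1}^n \mathbf 1_{(k/m,(k+1)/m]}(X_i)\Big\}P_{k,m-1}(x),\qquad (k/m,(k+1)/m]=\prod_{i=1}^d\Big(\frac{k_i}m,\frac{k_i+1}m\Big],$$ where the normalizing factor $c_m$ is either $\frac{(m-1+d)!}{(m-1)!}$ or $m^d$. Let $f_m(x)=\mathbb E[\hat f_{n,m}(x)]$,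 and for $x \in \mathrm{Int}(\mathcal S)$ let $$\psi(x)=\big[(4\pi)^d x_1\cdots x_d(1-\|x\|_1)\big]^{-1/2},$$ $$b(x)=\sum_{i=1}^d\Big(\frac12-x_i\Big)\frac{\partial f}{\partial x_i}(x)+\frac12\sum_{i,j=1}^d\big(x_i\mathbf 1_{\{i=j\}}-x_ix_j\big)\frac{\partial^2 f}{\partial x_i\partial x_j}(x)$$ (the latter when $f$ is $C^2$). Let $x\in\mathrm{Int}(\mathcal S)$ with $f(x)>0$, and let $m=m(n)\in\mathbb N$ with $m\to\infty$ as $n\to\infty$. 1. Assume that $f$ is Lipschitz continuous on $\mathcal S$ and $n^{1/2}m^{-d/4}\to\infty$. Then, for either choice of $c_m$, $$n^{1/2}m^{-d/4}\big(\hat f_{n,m}(x)-f_m(x)\big)\xrightarrow{\ \mathscr D\ }\mathcal N\big(0,\psi(x)f(x)\big).$$ 2. If, in addition to the assumptions of 1, $n^{1/2}m^{-d/4-1/2}\to0$, then, for either choice of $c_m$, $$n^{1/2}m^{-d/4}\big(\hat f_{n,m}(x)-f(x)\big)\xrightarrow{\ \mathscr D\ }\mathcal N\big(0,\psi(x)f(x)\big).$$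 3. Assume instead (without the rate conditions of 1 and 2) that $f$ is twice continuously differentiable on $\mathcal S$ and $n^{2/(d+4)}m^{-1}\to\lambda$ for some $\lambda>0$. Then, if $c_m=m^d$, $$n^{2/(d+4)}\big(\hat f_{n,m}(x)-f(x)\big)\xrightarrow{\ \mathscr D\ }\mathcal N\big(\lambda\,b(x),\ \lambda^{-d/2}\psi(x)f(x)\big),$$ and if $c_m=\frac{(m-1+d)!}{(m-1)!}$, the same holds with $b(x)$ replaced by $b(x)+\frac{d(d-1)}2f(x)$ (which equals $b(x)$ when $d=1$). -/

import Mathlib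

open MeasureTheory ProbabilityTheory Filter
open scoped Topology ENNReal NNReal Nat

namespace BernsteinSimplex

noncomputable section

/-- The norm `‖x‖₁ = ∑ |x_i|` on `ℝ^d`. -/
def l1Norm {d : ℕ} (x : Fin d → ℝ) : ℝ := ∑ i, |x i|

/-- The unit simplex `S = {x ∈ [0,1]^d : ‖x‖₁ ≤ 1}`. -/
def simplex (d : ℕ) : Set (Fin d → ℝ) :=
  {x | (∀ i, 0 ≤ x i ∧ x i ≤ 1) ∧ l1Norm x ≤ 1}

/-- The interior `{x ∈ (0,1)^d : ‖x‖₁ < 1}` of the simplex. -/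
def simplexInterior (d : ℕ) : Set (Fin d → ℝ) :=
  {x | (∀ i, 0 < x i ∧ x i < 1) ∧ l1Norm x < 1}

/-- The multi-indices `k ∈ ℕ₀^d` with `∑ k_i ≤ r`, i.e. `ℕ₀^d ∩ r S`. -/
def multiIndices (d r : ℕ) : Finset (Fin d → ℕ) :=
  (Fintype.piFinset fun _ : Fin d => Finset.range (r + 1)).filter fun k => ∑ i, k i ≤ r

/-- The multinomial weight `P_{k,r}(x)`, for `∑ k_i ≤ r`. -/
def multinomialWeight {d : ℕ} (k : Fin d → ℕ) (r : ℕ) (x : Fin d → ℝ) : ℝ :=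
  (r ! : ℝ) / (((r - ∑ i, k i)! : ℝ) * ∏ i, ((k i)! : ℝ)) *
    ((1 - l1Norm x) ^ (r - ∑ i, k i) * ∏ i, x i ^ k i)

/-- The half-open cube `(k/m, (k+1)/m]`. -/
def cube {d : ℕ} (k : Fin d → ℕ) (m : ℕ) : Set (Fin d → ℝ) :=
  {y | ∀ i, (k i : ℝ) / m < y i ∧ y i ≤ ((k i : ℝ) + 1) / m}

/-- The normalizing factor `(m-1+d)! / (m-1)!`; with it every component of the estimator is a
Dirichlet density. -/
def dirichletFactor (d m : ℕ) : ℝ := ((m - 1 + d)! : ℝ) / ((m - 1)! : ℝ)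

/-- The normalizing factor `m^d`, the inverse of the volume of a cube of side `1/m`. -/
def cubeFactor (d m : ℕ) : ℝ := (m : ℝ) ^ d

/-- The Bernstein density estimator of order `m` at `x`, built with the normalizing factor `c m`
from the first `n` observations `X 0, …, X (n-1)`. -/
def densityEstimator {d : ℕ} {Ω : Type*} (c : ℕ → ℝ) (X : ℕ → Ω → Fin d → ℝ) (n m : ℕ)
    (x : Fin d → ℝ) (ω : Ω) : ℝ :=
  ∑ k ∈ multiIndices d (m - 1),
    c m * ((n : ℝ)⁻¹ * ∑ i ∈ Finset.range n, (cube k m).indicator (fun _ => (1 : ℝ)) (X i ω)) *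
      multinomialWeight k (m - 1) x

/-- `f_m(x)`: the expectation of the density estimator. (It is the same for all `n ≥ 1` when the
observations are identically distributed.) -/
def meanEstimator {d : ℕ} {Ω : Type*} [MeasurableSpace Ω] (P : Measure Ω) (c : ℕ → ℝ)
    (X : ℕ → Ω → Fin d → ℝ) (n m : ℕ) (x : Fin d → ℝ) : ℝ :=
  ∫ ω, densityEstimator c X n m x ω ∂P

/-- `ψ(x) = [(4π)^d x_1 ⋯ x_d (1 - ‖x‖₁)]^{-1/2}`. -/
def psi {d : ℕ} (x : Fin d → ℝ) : ℝ :=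
  ((4 * Real.pi) ^ d * (∏ i, x i) * (1 - l1Norm x)) ^ (-(1 / 2) : ℝ)

/-- The partial derivative `∂g/∂x_i` of a function on the simplex. -/
def partialDeriv {d : ℕ} (i : Fin d) (g : (Fin d → ℝ) → ℝ) (x : Fin d → ℝ) : ℝ :=
  fderivWithin ℝ g (simplex d) x (Pi.single i 1)

/-- `b(x) = ∑_i (1/2 - x_i) ∂_i f(x) + 1/2 ∑_{i,j} (x_i 1_{i=j} - x_i x_j) ∂_i ∂_j f(x)`. -/
def biasTerm {d : ℕ} (f : (Fin d → ℝ) → ℝ) (x : Fin d → ℝ) : ℝ :=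
  ∑ i, (1 / 2 - x i) * partialDeriv i f x +
    1 / 2 * ∑ i, ∑ j, (x i * (if i = j then 1 else 0) - x i * x j) *
      partialDeriv i (partialDeriv j f) x

/-- The observations `X 0, X 1, …` are independent random vectors with density `f`, where `f` is
nonnegative and supported on the simplex. -/
structure IsIIDSample {d : ℕ} {Ω : Type*} [MeasurableSpace Ω] (P : Measure Ω)
    (X : ℕ → Ω → Fin d → ℝ) (f : (Fin d → ℝ) → ℝ) : Prop where
  measurable : ∀ i, Measurable (X i)
  indep : iIndepFun X P
  nonneg : ∀ y, 0 ≤ f y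
  support : ∀ y, y ∉ simplex d → f y = 0
  law : ∀ i, P.map (X i) = volume.withDensity fun y => ENNReal.ofReal (f y)

/-- The real random variables `Y n` converge in law to the normal law with mean `μ` and
variance `v`. -/
def ConvergesToNormal {Ω : Type*} [MeasurableSpace Ω] (P : Measure Ω) [IsProbabilityMeasure P]
    (Y : ℕ → Ω → ℝ) (μ v : ℝ) : Prop :=
  0 ≤ v ∧ TendstoInDistribution Y atTop (id : ℝ → ℝ) (fun _ => P) (gaussianReal μ v.toNNReal)

end

end BernsteinSimplex

/-! The estimator at `x` is an empirical mean of i.i.d. bounded variables, the values of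
`estimatorKernel`, whose law changes with `n` through `m`. Asymptotic normality is therefore a
central limit theorem for triangular arrays with i.i.d. rows (`convergesToNormal_sum_array`). It
needs three things: the scaled summands tend uniformly to 0, the row variance converges, and the row
mean minus the deterministic centering converges.

Variance. The cubes are disjoint, so squaring the kernel squares the weights, and its second moment
is about `m ^ d * f x * ∑ k, P_k ^ 2`. The last sum is the collision probability of two independent
multinomial vectors. By Parseval (`sum_multinomialWeight_sq`) it is an integral over the torus of
`|φ| ^ (2 * (m - 1))`, where `φ` is the characteristic function of one multinomial step. On the
scale `m ^ (-1/2)` the integrand becomes Gaussian, and the Gaussian integral is what produces `psi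
x` (`tendsto_sum_multinomialWeight_sq`): the sum is asymptotic to `m ^ (-d/2) * psi x`. Fourier
inversion also bounds every single weight by `O(m ^ (-d/2))`. Hence the kernel is `O(m ^ (d/2))`,
which makes the summands negligible, and `f` may be replaced by `f x` in the second moment. The
squared mean stays bounded and is lost against `m ^ (d/2)`. The estimator thus has variance
asymptotic to `m ^ (d/2) * psi x * f x / n`.

Bias. The mean is `c m / m ^ d` times `smoothedDensity`, the multinomial average of the cube
averages of `f`. The vector `k / m` has mean `x - x / m` and spread `m ^ (-1/2)`, so Lipschitz
regularity gives a bias `O(m ^ (-1/2))`. If `f` is C², Taylor expansion gives `biasTerm f x / m`;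
the `1/2` in its gradient part is the distance from the corner of a cube to its centre. The
normalization contributes `β * f x / m` with `β = lim m * (c m / m ^ d - 1)`, which is `0` or `d *
(d - 1) / 2`.

All three assertions are instances of `IsIIDSample.convergesToNormal_densityEstimator`, for
different scales and centerings. The centering is part of the array theorem, so no Slutsky argument
is needed. -/

namespace BernsteinSimplex

/-! ### Central limit theorem for triangular arrays -/

/-- Second-order expansion of the characteristic function of a bounded centered variable. -/
lemma norm_integral_exp_sub_le {Ω : Type*} [MeasurableSpace Ω] (P : Measure Ω)
    [IsProbabilityMeasure P] {Y : Ω → ℝ} (hY : Measurable Y) {B : ℝ} (hB : ∀ ω, |Y ω| ≤ B)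
    (h0 : ∫ ω, Y ω ∂P = 0) (t : ℝ) :
    ‖∫ ω, Complex.exp (t * Y ω * Complex.I) ∂P - 1 - (-(t ^ 2 / 2 * ∫ ω, Y ω ^ 2 ∂P) : ℝ)‖ ≤
      |t| ^ 3 * B * Real.exp (|t| * B) * ∫ ω, Y ω ^ 2 ∂P := by
  have hint : ∀ k : ℕ, Integrable (fun ω => Y ω ^ k) P := fun k =>
    Integrable.of_bound (hY.pow_const k).aestronglyMeasurable (B ^ k)
      (Eventually.of_forall fun ω => by
        rw [Real.norm_eq_abs, abs_pow]; exact pow_le_pow_left₀ (abs_nonneg _) (hB ω) k)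
  have hexp : Integrable (fun ω => Complex.exp (t * Y ω * Complex.I)) P :=
    Integrable.of_bound (by fun_prop) 1 (Eventually.of_forall fun ω => by
      rw [← Complex.ofReal_mul, Complex.norm_exp_ofReal_mul_I])
  have h1 : Integrable (fun ω => ((t * Y ω : ℝ) : ℂ) * Complex.I) P := by
    have := ((hint 1).const_mul t).ofReal (𝕜 := ℂ)
    simpa using this.mul_const Complex.I
  have h2 : Integrable (fun ω => ((-(t ^ 2 / 2 * Y ω ^ 2) : ℝ) : ℂ)) P := by
    exact ((hint 2).const_mul (t ^ 2 / 2)).neg.ofReal (𝕜 := ℂ)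
  have key : ∫ ω, Complex.exp (t * Y ω * Complex.I) ∂P - 1
      - (-(t ^ 2 / 2 * ∫ ω, Y ω ^ 2 ∂P) : ℝ) =
      ∫ ω, (Complex.exp (t * Y ω * Complex.I) - 1 - ((t * Y ω : ℝ) : ℂ) * Complex.I
        - ((-(t ^ 2 / 2 * Y ω ^ 2) : ℝ) : ℂ)) ∂P := by
    have h3 : Integrable (fun ω => Complex.exp (t * Y ω * Complex.I) - 1) P :=
      hexp.sub (integrable_const _)
    have h4 : Integrable (fun ω => Complex.exp (t * Y ω * Complex.I) - 1
        - ((t * Y ω : ℝ) : ℂ) * Complex.I) P := h3.sub h1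
    rw [integral_sub h4 h2, integral_sub h3 h1, integral_sub hexp (integrable_const _),
      integral_mul_const, integral_complex_ofReal, integral_complex_ofReal, integral_neg,
      integral_const_mul, integral_const_mul, h0]
    simp
  rw [key, ← integral_const_mul]
  refine norm_integral_le_of_norm_le ((hint 2).const_mul _) (Eventually.of_forall fun ω => ?_)
  -- The cubic Taylor remainder is used so that one factor `|Y|` can be replaced by `B` while `Y ^
  -- 2` is kept: the error is then a small multiple of the variance.
  have h := Complex.norm_exp_sub_sum_le_norm_mul_exp (t * Y ω * Complex.I) 3
  have e : ∑ k ∈ Finset.range 3, (t * Y ω * Complex.I) ^ k / (k ! : ℂ) =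
      1 + ((t * Y ω : ℝ) : ℂ) * Complex.I + ((-(t ^ 2 / 2 * Y ω ^ 2) : ℝ) : ℂ) := by
    simp only [Finset.sum_range_succ, Finset.sum_range_zero, Nat.factorial]
    push_cast
    rw [mul_pow _ _ 2, Complex.I_sq]
    ring
  rw [e] at h
  have hn : ‖(t * Y ω * Complex.I : ℂ)‖ = |t| * |Y ω| := by simp
  rw [hn] at h
  calc _ = ‖Complex.exp (t * Y ω * Complex.I) - (1 + ((t * Y ω : ℝ) : ℂ) * Complex.I
        + ((-(t ^ 2 / 2 * Y ω ^ 2) : ℝ) : ℂ))‖ := by congr 1; ring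
    _ ≤ (|t| * |Y ω|) ^ 3 * Real.exp (|t| * |Y ω|) := h
    _ = |t| ^ 3 * |Y ω| * Real.exp (|t| * |Y ω|) * Y ω ^ 2 := by rw [← sq_abs (Y ω)]; ring
    _ ≤ _ := by
      have := hB ω
      have : 0 ≤ B := (abs_nonneg _).trans this
      gcongr

/-- Central limit theorem for triangular arrays with uniformly small, identically distributed
rows. -/
theorem convergesToNormal_sum_array {Ω E : Type*} [MeasurableSpace Ω] [MeasurableSpace E]
    (P : Measure Ω) [IsProbabilityMeasure P] {X : ℕ → Ω → E} (hX : ∀ i, Measurable (X i))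
    (hindep : iIndepFun X P) {ν : Measure E} (hlaw : ∀ i, P.map (X i) = ν)
    {G : ℕ → E → ℝ} (hG : ∀ n, Measurable (G n)) {B : ℕ → ℝ}
    (hB : ∀ᶠ n in atTop, ∀ y, |G n y| ≤ B n) (hB0 : Tendsto B atTop (𝓝 0)) {v a : ℝ} (hv : 0 ≤ v)
    (hvar : Tendsto (fun n : ℕ => n * (∫ y, G n y ^ 2 ∂ν - (∫ y, G n y ∂ν) ^ 2)) atTop (𝓝 v))
    {s : ℕ → ℝ} (hs : Tendsto (fun n : ℕ => n * ∫ y, G n y ∂ν - s n) atTop (𝓝 a)) :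
    ConvergesToNormal P (fun n ω => ∑ i ∈ Finset.range n, G n (X i ω) - s n) a v := by
  have : IsProbabilityMeasure ν := by
    rw [← hlaw 0]; exact Measure.isProbabilityMeasure_map (hX 0).aemeasurable
  have hmeas : ∀ n, Measurable fun ω => ∑ i ∈ Finset.range n, G n (X i ω) - s n := fun n =>
    (Finset.measurable_fun_sum _ fun i _ => (hG n).comp (hX i)).sub_const _
  refine ⟨hv, ⟨fun n => (hmeas n).aemeasurable, aemeasurable_id, ?_⟩⟩
  refine ProbabilityMeasure.tendsto_iff_tendsto_charFun.2 fun t => ?_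
  simp only [ProbabilityMeasure.coe_mk, Measure.map_id]
  rw [charFun_gaussianReal, Real.coe_toNNReal v hv]
  set M : ℕ → ℝ := fun n => ∫ y, G n y ∂ν with hM
  -- `1 + g n` is the characteristic function of one centered summand, so the row has characteristic
  -- function a phase times `(1 + g n) ^ n`. It remains to show `n * g n → -v t² / 2`.
  set g : ℕ → ℂ := fun n => ∫ y, Complex.exp (t * (G n y - M n : ℝ) * Complex.I) ∂ν - 1 with hg
  have hchar : ∀ n, charFun (P.map fun ω => ∑ i ∈ Finset.range n, G n (X i ω) - s n) t =
      Complex.exp (t * (n * M n - s n : ℝ) * Complex.I) * (1 + g n) ^ n := by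
    intro n
    have e : (fun ω => ∑ i ∈ Finset.range n, G n (X i ω) - s n) =
        fun ω => ∑ i ∈ Finset.range n, (G n (X i ω) - M n) + (n * M n - s n) := by
      ext ω; simp [Finset.sum_sub_distrib]
    have hmY : ∀ i, Measurable fun ω => G n (X i ω) - M n := fun i =>
      ((hG n).comp (hX i)).sub_const _
    have hind : iIndepFun (fun i ω => G n (X i ω) - M n) P :=
      hindep.comp (fun _ y => G n y - M n) fun _ => (hG n).sub_const _
    have hone : ∀ i, charFun (P.map fun ω => G n (X i ω) - M n) t = 1 + g n := by
      intro i
      have : P.map (fun ω => G n (X i ω) - M n) = ν.map fun y => G n y - M n := by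
        rw [← hlaw i, Measure.map_map ((hG n).sub_const _) (hX i)]; rfl
      rw [this, charFun_apply_real, integral_map ((hG n).sub_const _).aemeasurable (by fun_prop)]
      simp [hg]
    have hsum := congrFun ((hind.restrict (Finset.range n)).charFun_map_fun_finsetSum_eq_prod
      fun i _ => (hmY i).aemeasurable) t
    rw [Finset.prod_apply, Finset.prod_congr rfl fun i _ => hone i, Finset.prod_const,
      Finset.card_range] at hsum
    rw [← hsum, e, charFun_apply_real, charFun_apply_real, integral_map (by fun_prop) (by fun_prop),
      integral_map (by fun_prop) (by fun_prop), ← integral_const_mul (μ := P)]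
    refine integral_congr_ae (Eventually.of_forall fun ω => ?_)
    simp only
    rw [← Complex.exp_add]; congr 1; push_cast; ring
  simp_rw [hchar]
  have h1 : Tendsto (fun n : ℕ => Complex.exp (t * (n * M n - s n : ℝ) * Complex.I)) atTop
      (𝓝 (Complex.exp (t * a * Complex.I))) := by
    refine (Complex.continuous_exp.tendsto _).comp ?_
    exact ((((Complex.continuous_ofReal.tendsto a).comp hs).const_mul (t : ℂ)).mul_const Complex.I)
  have h2 : Tendsto (fun n : ℕ => (n : ℂ) * g n) atTop (𝓝 (-(v * t ^ 2 / 2))) := by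
    set V : ℕ → ℝ := fun n => ∫ y, (G n y - M n) ^ 2 ∂ν with hV
    have hVeq : ∀ᶠ n in atTop, V n = ∫ y, G n y ^ 2 ∂ν - M n ^ 2 := by
      filter_upwards [hB] with n hn
      have i1 : Integrable (G n) ν := Integrable.of_bound (hG n).aestronglyMeasurable (B n)
        (Eventually.of_forall hn)
      have i2 : Integrable (fun y => G n y ^ 2) ν :=
        Integrable.of_bound ((hG n).pow_const 2).aestronglyMeasurable (B n ^ 2)
        (Eventually.of_forall fun y => by
          rw [Real.norm_eq_abs, abs_pow]; exact pow_le_pow_left₀ (abs_nonneg _) (hn y) 2)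
      have e : ∀ y, (G n y - M n) ^ 2 = G n y ^ 2 - 2 * M n * G n y + M n ^ 2 := fun y => by ring
      simp only [hV, e]
      have i3 : Integrable (fun y => G n y ^ 2 - 2 * M n * G n y) ν := i2.sub (i1.const_mul _)
      rw [integral_add i3 (integrable_const _),
        integral_sub i2 (i1.const_mul _), integral_const_mul]
      simp only [integral_const, probReal_univ, smul_eq_mul]
      simp only [hM]; ring
    have hnV : Tendsto (fun n : ℕ => n * V n) atTop (𝓝 v) := by
      refine hvar.congr' ?_
      filter_upwards [hVeq] with n hn
      rw [hn]
    -- Centering doubles the uniform bound, hence `2 * B n`.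
    have hbd : ∀ᶠ n : ℕ in atTop, ‖(n : ℂ) * g n - ((-(t ^ 2 / 2 * (n * V n)) : ℝ) : ℂ)‖ ≤
        |t| ^ 3 * (2 * B n) * Real.exp (|t| * (2 * B n)) * (n * V n) := by
      filter_upwards [hB] with n hn
      have i1 : Integrable (G n) ν := Integrable.of_bound (hG n).aestronglyMeasurable (B n)
        (Eventually.of_forall hn)
      have hMb : |M n| ≤ B n := by
        have := norm_integral_le_of_norm_le_const (μ := ν) (f := G n) (Eventually.of_forall hn)
        simpa using this
      have := norm_integral_exp_sub_le ν (Y := fun y => G n y - M n) ((hG n).sub_const _)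
        (B := 2 * B n) (fun y => (abs_sub _ _).trans (by linarith [hn y]))
        (by rw [integral_sub i1 (integrable_const _)]; simp [hM]) t
      have e : (n : ℂ) * g n - ((-(t ^ 2 / 2 * (n * V n)) : ℝ) : ℂ) =
          n * (g n - ((-(t ^ 2 / 2 * V n) : ℝ) : ℂ)) := by push_cast; ring
      rw [e, norm_mul, Complex.norm_natCast]
      calc _ ≤ (n : ℝ) * (|t| ^ 3 * (2 * B n) * Real.exp (|t| * (2 * B n)) * V n) := by
            gcongr
        _ = _ := by ring
    have hz : Tendsto (fun n : ℕ => |t| ^ 3 * (2 * B n) * Real.exp (|t| * (2 * B n)) * (n * V n))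
        atTop (𝓝 0) := by
      have h3 : Tendsto (fun n => Real.exp (|t| * (2 * B n))) atTop
          (𝓝 (Real.exp (|t| * (2 * 0)))) :=
        (Real.continuous_exp.tendsto _).comp ((hB0.const_mul 2).const_mul _)
      have := (((hB0.const_mul 2).const_mul (|t| ^ 3)).mul h3).mul hnV
      simpa using this
    have hd := squeeze_zero_norm' hbd hz
    have hl : Tendsto (fun n : ℕ => ((-(t ^ 2 / 2 * (n * V n)) : ℝ) : ℂ)) atTop
        (𝓝 ((-(t ^ 2 / 2 * v) : ℝ) : ℂ)) :=
      (Complex.continuous_ofReal.tendsto _).comp ((hnV.const_mul _).neg)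
    have := hd.add hl
    simp only [sub_add_cancel, zero_add] at this
    convert this using 2
    push_cast; ring
  have := h1.mul (Complex.tendsto_one_add_pow_exp_of_tendsto h2)
  rw [← Complex.exp_add] at this
  convert this using 3
  ring

/-! ### Multinomial weights: recursion, generating function, moments -/

section Multinomial

variable {d : ℕ}

lemma mem_multiIndices {r : ℕ} {k : Fin d → ℕ} : k ∈ multiIndices d r ↔ ∑ i, k i ≤ r := by
  simp only [multiIndices, Finset.mem_filter, Fintype.mem_piFinset, Finset.mem_range,
    and_iff_right_iff_imp]
  intro h i
  exact Nat.lt_succ_of_le ((Finset.single_le_sum (fun j _ => Nat.zero_le (k j))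
    (Finset.mem_univ i)).trans h)

lemma sum_add_single (k : Fin d → ℕ) (j : Fin d) :
    ∑ i, (k + Pi.single j 1 : Fin d → ℕ) i = ∑ i, k i + 1 := by
  simp [Finset.sum_add_distrib, Finset.sum_pi_single']

lemma prod_factorial_add_single (k : Fin d → ℕ) (j : Fin d) :
    ∏ i, (((k + Pi.single j 1 : Fin d → ℕ) i)! : ℝ) = (k j + 1) * ∏ i, ((k i)! : ℝ) := by
  have : ∀ i, (((k + Pi.single j 1 : Fin d → ℕ) i)! : ℝ) = (if i = j then (k j + 1 : ℝ) else 1) * ((k i)! : ℝ) := by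
    intro i
    by_cases h : i = j
    · subst h; simp [Nat.factorial_succ]
    · simp [h]
  simp_rw [this, Finset.prod_mul_distrib]
  simp

lemma prod_pow_add_single {R : Type*} [CommMonoid R] (z : Fin d → R) (k : Fin d → ℕ) (j : Fin d) :
    ∏ i, z i ^ (k + Pi.single j 1 : Fin d → ℕ) i = z j * ∏ i, z i ^ k i := by
  have : ∀ i, z i ^ (k + Pi.single j 1 : Fin d → ℕ) i = (if i = j then z j else 1) * z i ^ k i := by
    intro i
    by_cases h : i = j
    · subst h; simp [pow_succ']
    · simp [h]
  simp_rw [this, Finset.prod_mul_distrib]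
  simp

/-- The factor `k j + 1` cancels against the new factorial. Truncated subtraction satisfies `(r + 1)
- (s + 1) = r - s`, so this is valid for every `k`. -/
lemma multinomialWeight_add_single {r : ℕ} {k : Fin d → ℕ} (j : Fin d)
    (x : Fin d → ℝ) :
    ((k + Pi.single j 1 : Fin d → ℕ) j : ℝ) * multinomialWeight (k + Pi.single j 1 : Fin d → ℕ) (r + 1) x =
      (r + 1) * x j * multinomialWeight k r x := by
  have h1 : r + 1 - (∑ i, k i + 1) = r - ∑ i, k i := by omega
  have h2 : ((r - ∑ i, k i)! : ℝ) ≠ 0 := by positivity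
  have h3 : ∏ i, ((k i)! : ℝ) ≠ 0 := Finset.prod_ne_zero_iff.2 fun i _ => by positivity
  have h4 : (k j + 1 : ℝ) ≠ 0 := by positivity
  unfold multinomialWeight
  rw [sum_add_single, prod_factorial_add_single, prod_pow_add_single, h1, Nat.factorial_succ]
  simp only [Pi.add_apply, Pi.single_eq_same]
  push_cast
  field_simp

lemma multinomialWeight_succ {r : ℕ} {k : Fin d → ℕ} (hk : ∑ i, k i ≤ r) (x : Fin d → ℝ) :
    ((r + 1 : ℝ) - ∑ i, (k i : ℝ)) * multinomialWeight k (r + 1) x =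
      (r + 1) * (1 - l1Norm x) * multinomialWeight k r x := by
  obtain ⟨c, hc⟩ := Nat.exists_eq_add_of_le hk
  have h1 : r + 1 - ∑ i, k i = c + 1 := by omega
  have h1' : r - ∑ i, k i = c := by omega
  have h2 : (c ! : ℝ) ≠ 0 := by positivity
  have h3 : ∏ i, ((k i)! : ℝ) ≠ 0 := Finset.prod_ne_zero_iff.2 fun i _ => by positivity
  have h4 : (c + 1 : ℝ) ≠ 0 := by positivity
  have h5 : ((r + 1 : ℝ) - ∑ i, (k i : ℝ)) = c + 1 := by
    have : (r : ℝ) = ∑ i, (k i : ℝ) + c := by exact_mod_cast hc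
    rw [this]; ring
  unfold multinomialWeight
  rw [h5, h1, h1', Nat.factorial_succ, Nat.factorial_succ]
  push_cast
  field_simp
  ring

variable {A : Type*} [AddCommGroup A] [Module ℝ A]

/-- Size biasing of the multinomial distribution in the `j`-th coordinate. -/
lemma sum_multinomialWeight_coord (r : ℕ) (x : Fin d → ℝ) (j : Fin d) (g : (Fin d → ℕ) → A) :
    ∑ k ∈ multiIndices d (r + 1), ((k j : ℝ) * multinomialWeight k (r + 1) x) • g k =
      ((r + 1) * x j) • ∑ k ∈ multiIndices d r,
        multinomialWeight k r x • g (k + Pi.single j 1 : Fin d → ℕ) := by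
  -- Terms with `k j = 0` vanish; on the others, lowering coordinate `j` by one is a bijection onto
  -- the indices of order `r`.
  rw [Finset.smul_sum, ← Finset.sum_filter_of_ne (p := fun k : Fin d → ℕ => k j ≠ 0)]
  · symm
    refine Finset.sum_nbij' (fun k => k + Pi.single j 1) (fun k => k - Pi.single j 1) ?_ ?_ ?_ ?_ ?_
    · intro k hk
      rw [Finset.mem_filter, mem_multiIndices, sum_add_single]
      exact ⟨by have := mem_multiIndices.1 hk; omega, by simp⟩
    · intro k hk
      rw [Finset.mem_filter, mem_multiIndices] at hk
      have e : k = (k - Pi.single j 1) + Pi.single j 1 := by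
        ext i
        by_cases h : i = j
        · subst h; have := hk.2; simp only [Pi.add_apply, Pi.sub_apply, Pi.single_eq_same]; omega
        · simp [h]
      have h1 := hk.1
      rw [e, sum_add_single] at h1
      rw [mem_multiIndices]; omega
    · intro k _; simp
    · intro k hk
      rw [Finset.mem_filter] at hk
      ext i
      by_cases h : i = j
      · subst h; have := hk.2; simp only [Pi.add_apply, Pi.sub_apply, Pi.single_eq_same]; omega
      · simp [h]
    · intro k _
      rw [multinomialWeight_add_single, smul_smul]
  · intro k _ h h0
    simp [h0] at h

/-- Size biasing in the residual coordinate `r + 1 - ∑ k i`: indices with `∑ k i = r + 1` carry the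
factor 0, which is why the sum drops to order `r` without a shift. -/
lemma sum_multinomialWeight_rest (r : ℕ) (x : Fin d → ℝ) (g : (Fin d → ℕ) → A) :
    ∑ k ∈ multiIndices d (r + 1),
        (((r + 1 : ℝ) - ∑ i, (k i : ℝ)) * multinomialWeight k (r + 1) x) • g k =
      ((r + 1) * (1 - l1Norm x)) • ∑ k ∈ multiIndices d r, multinomialWeight k r x • g k := by
  have hsub : multiIndices d r ⊆ multiIndices d (r + 1) := fun k hk => by
    rw [mem_multiIndices] at *; omega
  rw [Finset.smul_sum, ← Finset.sum_subset hsub]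
  · refine Finset.sum_congr rfl fun k hk => ?_
    rw [multinomialWeight_succ (mem_multiIndices.1 hk), smul_smul]
  · intro k hk hk'
    rw [mem_multiIndices] at hk hk'
    have : ∑ i, k i = r + 1 := by omega
    have : ∑ i, (k i : ℝ) = r + 1 := by exact_mod_cast this
    simp [this]

/-- One-step recursion for multinomial expectations. -/
lemma sum_multinomialWeight_succ (r : ℕ) (x : Fin d → ℝ) (g : (Fin d → ℕ) → A) :
    ∑ k ∈ multiIndices d (r + 1), multinomialWeight k (r + 1) x • g k =
      (1 - l1Norm x) • ∑ k ∈ multiIndices d r, multinomialWeight k r x • g k +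
      ∑ j, x j • ∑ k ∈ multiIndices d r, multinomialWeight k r x • g (k + Pi.single j 1 : Fin d → ℕ) := by
  have hr : (r + 1 : ℝ) ≠ 0 := by positivity
  -- All coordinates of `k`, the residual one included, add up to `r + 1`. Splitting this factor and
  -- size biasing each piece gives the recursion.
  have h : (r + 1 : ℝ) • ∑ k ∈ multiIndices d (r + 1), multinomialWeight k (r + 1) x • g k =
      (r + 1 : ℝ) • ((1 - l1Norm x) • ∑ k ∈ multiIndices d r, multinomialWeight k r x • g k +
      ∑ j, x j • ∑ k ∈ multiIndices d r,
        multinomialWeight k r x • g (k + Pi.single j 1 : Fin d → ℕ)) := by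
    rw [smul_add, smul_smul, ← sum_multinomialWeight_rest, Finset.smul_sum, Finset.smul_sum]
    simp_rw [smul_smul ((r : ℝ) + 1) (x _), ← sum_multinomialWeight_coord]
    rw [Finset.sum_comm, ← Finset.sum_add_distrib]
    refine Finset.sum_congr rfl fun k _ => ?_
    rw [← Finset.sum_smul, ← add_smul, smul_smul, ← Finset.sum_mul]
    congr 1; ring
  exact smul_right_injective A hr h

lemma multiIndices_zero : multiIndices d 0 = {0} := by
  ext k
  rw [mem_multiIndices, Finset.mem_singleton]
  constructor
  · intro h; ext i
    have := Finset.single_le_sum (fun j _ => Nat.zero_le (k j)) (Finset.mem_univ i)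
    simp only [Pi.zero_apply]; omega
  · rintro rfl; simp

lemma multinomialWeight_zero (x : Fin d → ℝ) : multinomialWeight (0 : Fin d → ℕ) 0 x = 1 := by
  simp [multinomialWeight]

/-- The multinomial theorem: the generating function of the multinomial weights. -/
lemma sum_multinomialWeight_prod_pow {R : Type*} [CommRing R] [Algebra ℝ R] (r : ℕ)
    (x : Fin d → ℝ) (z : Fin d → R) :
    ∑ k ∈ multiIndices d r, multinomialWeight k r x • ∏ i, z i ^ k i =
      (algebraMap ℝ R (1 - l1Norm x) + ∑ j, x j • z j) ^ r := by
  induction r with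
  | zero => simp [multiIndices_zero, multinomialWeight_zero]
  | succ r ih =>
    rw [sum_multinomialWeight_succ, ih]
    have : ∀ j, ∑ k ∈ multiIndices d r,
        multinomialWeight k r x • ∏ i, z i ^ (k + Pi.single j 1 : Fin d → ℕ) i =
        z j * (algebraMap ℝ R (1 - l1Norm x) + ∑ j, x j • z j) ^ r := by
      intro j
      rw [← ih, Finset.mul_sum]
      refine Finset.sum_congr rfl fun k _ => ?_
      rw [prod_pow_add_single, mul_smul_comm]
    simp_rw [this, ← smul_mul_assoc, ← Finset.sum_mul]
    rw [Algebra.smul_def, ← add_mul, pow_succ']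

lemma multinomialWeight_nonneg {x : Fin d → ℝ} (hx : ∀ i, 0 ≤ x i) (hx1 : l1Norm x ≤ 1)
    (k : Fin d → ℕ) (r : ℕ) : 0 ≤ multinomialWeight k r x := by
  have : 0 ≤ 1 - l1Norm x := by linarith
  have h2 : 0 ≤ ∏ i, x i ^ k i := Finset.prod_nonneg fun i _ => pow_nonneg (hx i) _
  unfold multinomialWeight
  positivity

lemma l1Norm_eq_sum {x : Fin d → ℝ} (hx : ∀ i, 0 ≤ x i) : l1Norm x = ∑ i, x i :=
  Finset.sum_congr rfl fun i _ => abs_of_nonneg (hx i)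

lemma sum_multinomialWeight {x : Fin d → ℝ} (hx : ∀ i, 0 ≤ x i) (r : ℕ) :
    ∑ k ∈ multiIndices d r, multinomialWeight k r x = 1 := by
  have := sum_multinomialWeight_prod_pow (R := ℝ) r x (fun _ => 1)
  simpa [l1Norm_eq_sum hx] using this

/-- The first moments of the multinomial distribution. -/
lemma sum_multinomialWeight_mul_coord {x : Fin d → ℝ} (hx : ∀ i, 0 ≤ x i) (r : ℕ) (i : Fin d) :
    ∑ k ∈ multiIndices d r, multinomialWeight k r x * k i = r * x i := by
  induction r with
  | zero => simp [multiIndices_zero]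
  | succ r _ =>
    have := sum_multinomialWeight_coord (A := ℝ) r x i (fun _ => 1)
    simp only [smul_eq_mul, mul_one, sum_multinomialWeight hx] at this
    push_cast
    rw [← this]
    exact Finset.sum_congr rfl fun k _ => mul_comm _ _

/-- The mixed second moments of the multinomial distribution. -/
lemma sum_multinomialWeight_mul_coord_mul_coord {x : Fin d → ℝ} (hx : ∀ i, 0 ≤ x i) (r : ℕ)
    (i j : Fin d) :
    ∑ k ∈ multiIndices d r, multinomialWeight k r x * (k i * k j) =
      r * (r - 1) * (x i * x j) + r * (x i * if i = j then 1 else 0) := by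
  cases r with
  | zero => simp [multiIndices_zero]
  | succ r =>
    have := sum_multinomialWeight_coord (A := ℝ) r x i (fun k => (k j : ℝ))
    have e : ∀ k : Fin d → ℕ, (((k + Pi.single i 1 : Fin d → ℕ) j : ℕ) : ℝ) = k j + if i = j then 1 else 0 := by
      intro k
      by_cases h : i = j
      · subst h; simp
      · simp [h, Ne.symm h]
    simp only [smul_eq_mul, e, mul_add, Finset.sum_add_distrib, ← Finset.sum_mul,
      sum_multinomialWeight hx, sum_multinomialWeight_mul_coord hx] at this
    push_cast
    rw [show ((r : ℝ) + 1) * (r + 1 - 1) * (x i * x j) + (r + 1) * (x i * if i = j then 1 else 0) =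
      (r + 1) * x i * (r * x j) + (r + 1) * x i * (1 * if i = j then 1 else 0) by ring, ← this]
    exact Finset.sum_congr rfl fun k _ => by ring

/-- The covariances of the multinomial distribution. -/
lemma sum_multinomialWeight_cov {x : Fin d → ℝ} (hx : ∀ i, 0 ≤ x i) (r : ℕ) (i j : Fin d) :
    ∑ k ∈ multiIndices d r, multinomialWeight k r x * ((k i - r * x i) * (k j - r * x j)) =
      r * (x i * (if i = j then 1 else 0) - x i * x j) := by
  have e : ∀ k : Fin d → ℕ, multinomialWeight k r x * ((k i - r * x i) * (k j - r * x j)) =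
      multinomialWeight k r x * (k i * k j) - multinomialWeight k r x * k i * (r * x j) -
      multinomialWeight k r x * k j * (r * x i) + multinomialWeight k r x * (r * x i * (r * x j)) :=
    fun k => by ring
  simp_rw [e, Finset.sum_add_distrib, Finset.sum_sub_distrib, ← Finset.sum_mul,
    sum_multinomialWeight hx, sum_multinomialWeight_mul_coord hx,
    sum_multinomialWeight_mul_coord_mul_coord hx]
  ring

/-- The generating function at `exp s` in coordinate `i` and 1 elsewhere, with the centering `exp
(-(s * r * x i))` distributed over the `r` factors. -/
lemma sum_multinomialWeight_exp {x : Fin d → ℝ} (r : ℕ) (i : Fin d) (s : ℝ) :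
    ∑ k ∈ multiIndices d r, multinomialWeight k r x * Real.exp (s * (k i - r * x i)) =
      ((1 - l1Norm x) * Real.exp (-(s * x i)) +
        ∑ j, x j * Real.exp (s * ((if j = i then 1 else 0) - x i))) ^ r := by
  have h := sum_multinomialWeight_prod_pow (R := ℝ) r x
    (fun j => if j = i then Real.exp s else 1)
  have e1 : ∀ k : Fin d → ℕ, ∏ j, (if j = i then Real.exp s else 1) ^ k j = Real.exp (s * k i) := by
    intro k
    have : ∀ j, (if j = i then Real.exp s else 1) ^ k j = if j = i then Real.exp (s * k j) else 1 := by
      intro j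
      split_ifs
      · rw [← Real.exp_nat_mul, mul_comm]
      · simp
    simp_rw [this]; simp
  simp_rw [e1] at h
  simp only [smul_eq_mul, Algebra.algebraMap_self, RingHom.id_apply] at h
  have e2 : (1 - l1Norm x) * Real.exp (-(s * x i)) +
        ∑ j, x j * Real.exp (s * ((if j = i then 1 else 0) - x i)) =
      Real.exp (-(s * x i)) * (1 - l1Norm x + ∑ j, x j * if j = i then Real.exp s else 1) := by
    rw [mul_add, Finset.mul_sum, mul_comm]
    congr 1
    refine Finset.sum_congr rfl fun j _ => ?_
    rw [mul_sub, sub_eq_add_neg, Real.exp_add]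
    split_ifs <;> simp <;> ring
  rw [e2, mul_pow, ← h, Finset.mul_sum, ← Real.exp_nat_mul]
  refine Finset.sum_congr rfl fun k _ => ?_
  rw [mul_left_comm, ← Real.exp_add]
  congr 2; ring

/-- The fourth central moments of the multinomial marginals are of order `r ^ 2`. -/
lemma sum_multinomialWeight_fourth_le {x : Fin d → ℝ} (hx : ∀ i, 0 ≤ x i) (hx1 : l1Norm x ≤ 1)
    (r : ℕ) (i : Fin d) :
    ∑ k ∈ multiIndices d r, multinomialWeight k r x * (k i - r * x i) ^ 4 ≤
      48 * Real.exp 1 * (r : ℝ) ^ 2 := by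
  rcases Nat.eq_zero_or_pos r with rfl | hr
  · simp [multiIndices_zero]
  have hr' : (1 : ℝ) ≤ r := by exact_mod_cast hr
  have hxi1 : x i ≤ 1 := by
    rw [l1Norm_eq_sum hx] at hx1
    exact (Finset.single_le_sum (fun j _ => hx j) (Finset.mem_univ i)).trans hx1
  have hle : ∀ s : ℝ, |s| ≤ 1 →
      ∑ k ∈ multiIndices d r, multinomialWeight k r x * Real.exp (s * (k i - r * x i)) ≤
        Real.exp (r * s ^ 2) := by
    intro s hs
    -- From `exp v ≤ 1 + v + v ^ 2` for `|v| ≤ 1`; the centered steps take values in `[-1, 1]`.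
    have hexp : ∀ u : ℝ, |u| ≤ 1 → Real.exp (s * u) ≤ 1 + s * u + s ^ 2 := by
      intro u hu
      have hsu : |s * u| ≤ |s| := by
        rw [abs_mul]; exact mul_le_of_le_one_right (abs_nonneg _) hu
      have h := (abs_le.1 (Real.abs_exp_sub_one_sub_id_le (hsu.trans hs))).2
      have : (s * u) ^ 2 ≤ s ^ 2 := sq_le_sq.2 hsu
      linarith
    rw [sum_multinomialWeight_exp, Real.exp_nat_mul]
    have hx0 : 0 ≤ 1 - l1Norm x := by linarith
    refine pow_le_pow_left₀ (add_nonneg (by positivity)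
      (Finset.sum_nonneg fun j _ => mul_nonneg (hx j) (Real.exp_pos _).le)) ?_ r
    calc _ ≤ (1 - l1Norm x) * (1 + s * (-x i) + s ^ 2) +
          ∑ j, x j * (1 + s * ((if j = i then 1 else 0) - x i) + s ^ 2) := by
          refine add_le_add (mul_le_mul_of_nonneg_left ?_ hx0)
            (Finset.sum_le_sum fun j _ => mul_le_mul_of_nonneg_left (hexp _ ?_) (hx j))
          · rw [← mul_neg]
            exact hexp _ (by rw [abs_neg, abs_of_nonneg (hx i)]; exact hxi1)
          · have := hx i
            split_ifs <;> rw [abs_le] <;> constructor <;> linarith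
      -- The linear terms cancel because a centered step has mean zero.
      _ = 1 + s ^ 2 := by
          have e : ∀ j, x j * (1 + s * ((if j = i then 1 else 0) - x i) + s ^ 2) =
              x j * (1 - s * x i + s ^ 2) + (if j = i then s * x j else 0) := by
            intro j; split_ifs <;> ring
          simp_rw [e, Finset.sum_add_distrib, ← Finset.sum_mul, ← l1Norm_eq_sum hx]
          simp only [Finset.sum_ite_eq', Finset.mem_univ, if_true]
          ring
      _ ≤ _ := by linarith [Real.add_one_le_exp (s ^ 2)]
  -- `24 = 4!`: the quartic term of the exponential series, at whichever of `u` and `-u` is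
  -- nonnegative.
  have hquart : ∀ u : ℝ, u ^ 4 ≤ 24 * (Real.exp u + Real.exp (-u)) := by
    intro u
    have h : ∀ v : ℝ, 0 ≤ v → v ^ 4 ≤ 24 * (Real.exp v + Real.exp (-v)) := by
      intro v hv
      have h1 := Real.sum_le_exp_of_nonneg hv 5
      simp only [Finset.sum_range_succ, Finset.sum_range_zero, Nat.factorial] at h1
      push_cast at h1
      have h2 : 0 ≤ v ^ 3 := by positivity
      have h3 := Real.exp_pos (-v)
      nlinarith [sq_nonneg v]
    rcases le_total 0 u with hu | hu
    · exact h u hu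
    · have := h (-u) (by linarith)
      rw [neg_neg, add_comm] at this
      calc u ^ 4 = (-u) ^ 4 := by ring
        _ ≤ _ := this
  -- With `r * s ^ 2 = 1` both exponential moments are at most `exp 1`, whence the constant `24 * 2
  -- * exp 1`.
  set s : ℝ := (Real.sqrt r)⁻¹ with hsdef
  have hsr : s ^ 2 * r = 1 := by
    rw [hsdef, inv_pow, Real.sq_sqrt (by positivity)]; field_simp
  have hs1 : |s| ≤ 1 := by
    rw [abs_of_nonneg (by positivity)]
    exact inv_le_one_of_one_le₀ (Real.one_le_sqrt.2 hr')
  have h1 := hle s hs1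
  have h2 := hle (-s) (by rwa [abs_neg])
  rw [neg_sq] at h2
  rw [mul_comm (r : ℝ) (s ^ 2), hsr] at h1 h2
  have hmain : s ^ 4 * ∑ k ∈ multiIndices d r, multinomialWeight k r x * (k i - r * x i) ^ 4 ≤
      48 * Real.exp 1 := by
    calc _ = ∑ k ∈ multiIndices d r, multinomialWeight k r x * (s * (k i - r * x i)) ^ 4 := by
          rw [Finset.mul_sum]; exact Finset.sum_congr rfl fun k _ => by ring
      _ ≤ ∑ k ∈ multiIndices d r, multinomialWeight k r x *
          (24 * (Real.exp (s * (k i - r * x i)) + Real.exp (-(s * (k i - r * x i))))) :=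
          Finset.sum_le_sum fun k _ => mul_le_mul_of_nonneg_left (hquart _)
            (multinomialWeight_nonneg hx hx1 _ _)
      _ = 24 * (∑ k ∈ multiIndices d r, multinomialWeight k r x * Real.exp (s * (k i - r * x i)) +
          ∑ k ∈ multiIndices d r, multinomialWeight k r x * Real.exp (-s * (k i - r * x i))) := by
          rw [← Finset.sum_add_distrib, Finset.mul_sum]
          exact Finset.sum_congr rfl fun k _ => by rw [neg_mul]; ring
      _ ≤ _ := by linarith
  have h4 : s ^ 4 * (r : ℝ) ^ 2 = 1 := by
    calc s ^ 4 * (r : ℝ) ^ 2 = (s ^ 2 * r) ^ 2 := by ring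
      _ = 1 := by rw [hsr]; ring
  calc _ = (s ^ 4 * ∑ k ∈ multiIndices d r, multinomialWeight k r x * (k i - r * x i) ^ 4)
        * (r : ℝ) ^ 2 := by
        rw [mul_right_comm, h4, one_mul]
    _ ≤ _ := by gcongr

end Multinomial

/-! ### Fourier analysis of the multinomial weights on the torus -/

section Fourier

variable {d : ℕ}

/-- The characteristic function of one step of the multinomial walk. -/
noncomputable def stepCharFun (x t : Fin d → ℝ) : ℂ :=
  ((1 - l1Norm x : ℝ) : ℂ) + ∑ j, (x j : ℂ) * Complex.exp (t j * Complex.I)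

/-- The fundamental domain `(-π, π]^d` of the torus. -/
def torusBox (d : ℕ) : Set (Fin d → ℝ) := Set.univ.pi fun _ => Set.Ioc (-Real.pi) Real.pi

lemma measurableSet_torusBox : MeasurableSet (torusBox d) :=
  MeasurableSet.univ_pi fun _ => measurableSet_Ioc

lemma volume_restrict_torusBox : (volume : Measure (Fin d → ℝ)).restrict (torusBox d) =
    Measure.pi fun _ => volume.restrict (Set.Ioc (-Real.pi) Real.pi) := by
  rw [volume_pi, torusBox, Measure.restrict_pi_pi]

lemma continuous_stepCharFun (x : Fin d → ℝ) : Continuous (stepCharFun x) := by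
  unfold stepCharFun; fun_prop

lemma integral_exp_int_mul (n : ℤ) :
    ∫ t in Set.Ioc (-Real.pi) Real.pi, Complex.exp (n * (t * Complex.I)) =
      if n = 0 then (2 * Real.pi : ℂ) else 0 := by
  have hpi := Real.pi_pos
  rw [← intervalIntegral.integral_of_le (by linarith)]
  split_ifs with h
  · subst h; simp; ring
  · have hc : (n : ℂ) * Complex.I ≠ 0 := mul_ne_zero (by exact_mod_cast h) Complex.I_ne_zero
    have e : ∀ t : ℝ, (n : ℂ) * (t * Complex.I) = n * Complex.I * t := fun t => by ring
    simp_rw [e]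
    rw [integral_exp_mul_complex hc, div_eq_zero_iff, sub_eq_zero]
    left
    rw [Complex.exp_eq_exp_iff_exists_int]
    exact ⟨n, by push_cast; ring⟩

lemma integral_torusBox_exp (l k : Fin d → ℕ) :
    ∫ t in torusBox d, (∏ j, Complex.exp (t j * Complex.I) ^ l j) *
        ∏ j, Complex.exp (-(t j * Complex.I)) ^ k j =
      if l = k then (2 * Real.pi : ℂ) ^ d else 0 := by
  have e : ∀ t : Fin d → ℝ, (∏ j, Complex.exp (t j * Complex.I) ^ l j) *
      ∏ j, Complex.exp (-(t j * Complex.I)) ^ k j =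
      ∏ j, Complex.exp (((l j - k j : ℤ) : ℂ) * (t j * Complex.I)) := by
    intro t
    rw [← Finset.prod_mul_distrib]
    refine Finset.prod_congr rfl fun j _ => ?_
    rw [← Complex.exp_nat_mul, ← Complex.exp_nat_mul, ← Complex.exp_add]
    congr 1; push_cast; ring
  simp_rw [e]
  rw [volume_restrict_torusBox, integral_fintype_prod_eq_prod
    (f := fun j (s : ℝ) => Complex.exp (((l j - k j : ℤ) : ℂ) * (s * Complex.I)))]
  simp_rw [integral_exp_int_mul]
  split_ifs with h
  · subst h; simp
  · obtain ⟨j, hj⟩ := Function.ne_iff.1 h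
    refine Finset.prod_eq_zero (Finset.mem_univ j) (if_neg ?_)
    omega

lemma integrable_torusBox {g : (Fin d → ℝ) → ℂ} (hg : Continuous g) :
    IntegrableOn g (torusBox d) := by
  have hK : IsCompact (Set.univ.pi fun _ : Fin d => Set.Icc (-Real.pi) Real.pi) :=
    isCompact_univ_pi fun _ => isCompact_Icc
  exact (hg.continuousOn.integrableOn_compact hK).mono_set
    (Set.pi_mono fun _ _ => Set.Ioc_subset_Icc_self)

lemma stepCharFun_pow (x t : Fin d → ℝ) (r : ℕ) :
    stepCharFun x t ^ r = ∑ k ∈ multiIndices d r,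
      (multinomialWeight k r x : ℂ) * ∏ j, Complex.exp (t j * Complex.I) ^ k j := by
  have := sum_multinomialWeight_prod_pow (R := ℂ) r x fun j => Complex.exp (t j * Complex.I)
  simp only [Complex.real_smul, Complex.coe_algebraMap] at this
  exact this.symm

/-- Fourier inversion for the multinomial weights. -/
lemma integral_stepCharFun_pow (x : Fin d → ℝ) {r : ℕ} {k : Fin d → ℕ}
    (hk : k ∈ multiIndices d r) :
    ∫ t in torusBox d, stepCharFun x t ^ r * ∏ j, Complex.exp (-(t j * Complex.I)) ^ k j =
      (2 * Real.pi : ℂ) ^ d * multinomialWeight k r x := by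
  simp_rw [stepCharFun_pow, Finset.sum_mul, mul_assoc]
  rw [integral_finsetSum]
  · simp_rw [integral_const_mul, integral_torusBox_exp]
    simp [hk, mul_comm]
  · intro l _
    exact integrable_torusBox (by fun_prop)

/-- Fourier inversion with all phases dropped; the bound no longer depends on `k`. -/
lemma multinomialWeight_le_integral (x : Fin d → ℝ) {r : ℕ} {k : Fin d → ℕ}
    (hk : k ∈ multiIndices d r) :
    (2 * Real.pi) ^ d * multinomialWeight k r x ≤ ∫ t in torusBox d, ‖stepCharFun x t‖ ^ r := by
  have h := congrArg norm (integral_stepCharFun_pow x hk)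
  have hle : (2 * Real.pi) ^ d * multinomialWeight k r x ≤
      ‖(2 * Real.pi : ℂ) ^ d * multinomialWeight k r x‖ := by
    have : (2 * Real.pi : ℂ) ^ d * multinomialWeight k r x =
        (((2 * Real.pi) ^ d * multinomialWeight k r x : ℝ) : ℂ) := by push_cast; ring
    rw [this, Complex.norm_real]; exact le_abs_self _
  refine hle.trans (h ▸ (norm_integral_le_integral_norm _).trans (le_of_eq ?_))
  refine integral_congr_ae (Eventually.of_forall fun t => ?_)
  have : ∀ j, ‖Complex.exp (-(t j * Complex.I))‖ = 1 := fun j => by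
    rw [← neg_mul, ← Complex.ofReal_neg, Complex.norm_exp_ofReal_mul_I]
  simp [norm_prod, this]

/-- Parseval's identity for the multinomial weights. -/
lemma sum_multinomialWeight_sq (x : Fin d → ℝ) (r : ℕ) :
    (2 * Real.pi) ^ d * ∑ k ∈ multiIndices d r, multinomialWeight k r x ^ 2 =
      ∫ t in torusBox d, Complex.normSq (stepCharFun x t) ^ r := by
  have hconj : ∀ t, (starRingEnd ℂ) (stepCharFun x t ^ r) = ∑ k ∈ multiIndices d r,
      (multinomialWeight k r x : ℂ) * ∏ j, Complex.exp (-(t j * Complex.I)) ^ k j := by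
    intro t
    rw [stepCharFun_pow, map_sum]
    refine Finset.sum_congr rfl fun k _ => ?_
    rw [map_mul, Complex.conj_ofReal, map_prod]
    congr 1
    refine Finset.prod_congr rfl fun j _ => ?_
    rw [map_pow, ← Complex.exp_conj]
    simp
  have : ((∫ t in torusBox d, Complex.normSq (stepCharFun x t) ^ r : ℝ) : ℂ) =
      (((2 * Real.pi) ^ d * ∑ k ∈ multiIndices d r, multinomialWeight k r x ^ 2 : ℝ) : ℂ) := by
    rw [← integral_complex_ofReal]
    -- Only the conjugate factor of `φ ^ r * conj (φ ^ r)` is expanded, so each term integrates to a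
    -- weight by Fourier inversion.
    have e : ∀ t, ((Complex.normSq (stepCharFun x t) ^ r : ℝ) : ℂ) = ∑ k ∈ multiIndices d r,
        (multinomialWeight k r x : ℂ) *
          (stepCharFun x t ^ r * ∏ j, Complex.exp (-(t j * Complex.I)) ^ k j) := by
      intro t
      rw [← map_pow, ← Complex.mul_conj, hconj, Finset.mul_sum]
      exact Finset.sum_congr rfl fun k _ => by ring
    simp_rw [e]
    rw [integral_finsetSum]
    · simp_rw [integral_const_mul]
      rw [Finset.sum_congr rfl fun k hk => by rw [integral_stepCharFun_pow x hk]]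
      push_cast
      rw [Finset.mul_sum]
      exact Finset.sum_congr rfl fun k _ => by ring
    · intro k _
      exact (integrable_torusBox (((continuous_stepCharFun x).pow r).mul (by fun_prop))).const_mul _
  exact_mod_cast this.symm

lemma normSq_stepCharFun (x t : Fin d → ℝ) :
    Complex.normSq (stepCharFun x t) =
      (1 - l1Norm x + ∑ j, x j * Real.cos (t j)) ^ 2 + (∑ j, x j * Real.sin (t j)) ^ 2 := by
  have hre : (stepCharFun x t).re = 1 - l1Norm x + ∑ j, x j * Real.cos (t j) := by
    simp [stepCharFun, Complex.exp_ofReal_mul_I_re]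
  have him : (stepCharFun x t).im = ∑ j, x j * Real.sin (t j) := by
    simp [stepCharFun, Complex.exp_ofReal_mul_I_im]
  rw [Complex.normSq_apply, hre, him]; ring

/-- With `A = 1 - l1Norm x` and `z = ∑ x j * exp (i t j)`, expand `|A + z|² = A² + 2 A Re z + |z|²`.
Since `|z| ≤ 1 - A`, the loss is at least `2 A` times the deficit of `Re z`, which `cos t ≤ 1 - 2 t²
/ π²` makes quadratic on the whole torus. The mass `A` left at the origin is what prevents the
modulus from staying near 1. -/
lemma normSq_stepCharFun_le {x : Fin d → ℝ} (hx : ∀ i, 0 ≤ x i) (hx1 : l1Norm x ≤ 1)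
    {t : Fin d → ℝ} (ht : t ∈ torusBox d) :
    Complex.normSq (stepCharFun x t) ≤
      Real.exp (-∑ j, 4 * (1 - l1Norm x) * x j / Real.pi ^ 2 * t j ^ 2) := by
  have hs := l1Norm_eq_sum hx
  have hcs : (∑ j, x j * Real.cos (t j)) ^ 2 + (∑ j, x j * Real.sin (t j)) ^ 2 ≤
      (∑ j, x j) ^ 2 := by
    have e : ((∑ j, x j * Real.cos (t j)) ^ 2 + (∑ j, x j * Real.sin (t j)) ^ 2) =
        ‖∑ j, (x j : ℂ) * Complex.exp (t j * Complex.I)‖ ^ 2 := by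
      rw [← Complex.normSq_eq_norm_sq, Complex.normSq_apply]
      simp [Complex.exp_ofReal_mul_I_re, Complex.exp_ofReal_mul_I_im]; ring
    rw [e]
    refine pow_le_pow_left₀ (norm_nonneg _) ((norm_sum_le _ _).trans (Finset.sum_le_sum ?_)) 2
    intro j _
    rw [norm_mul, Complex.norm_exp_ofReal_mul_I, mul_one, Complex.norm_real, Real.norm_eq_abs,
      abs_of_nonneg (hx j)]
  have hcos : ∑ j, x j * Real.cos (t j) ≤ ∑ j, x j - ∑ j, x j * (2 / Real.pi ^ 2 * t j ^ 2) := by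
    rw [← Finset.sum_sub_distrib]
    refine Finset.sum_le_sum fun j _ => ?_
    have hj := ht j (Set.mem_univ j)
    have := Real.cos_le_one_sub_mul_cos_sq (abs_le.2 ⟨hj.1.le, hj.2⟩)
    nlinarith [mul_le_mul_of_nonneg_left this (hx j)]
  have h0 : 0 ≤ 1 - l1Norm x := by linarith
  have e : ∑ j, 4 * (1 - l1Norm x) * x j / Real.pi ^ 2 * t j ^ 2 =
      2 * (1 - l1Norm x) * ∑ j, x j * (2 / Real.pi ^ 2 * t j ^ 2) := by
    rw [Finset.mul_sum]; exact Finset.sum_congr rfl fun j _ => by ring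
  rw [normSq_stepCharFun, e]
  refine le_trans ?_ (Real.add_one_le_exp _)
  rw [← hs] at hcs hcos
  nlinarith [mul_le_mul_of_nonneg_left hcos h0]

lemma integrable_exp_neg_sum_sq {a : Fin d → ℝ} (ha : ∀ j, 0 < a j) :
    Integrable fun t : Fin d → ℝ => Real.exp (-∑ j, a j * t j ^ 2) := by
  have e : ∀ t : Fin d → ℝ, Real.exp (-∑ j, a j * t j ^ 2) = ∏ j, Real.exp (-a j * t j ^ 2) := by
    intro t
    rw [← Real.exp_sum, ← Finset.sum_neg_distrib]; simp
  simp_rw [e]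
  exact Integrable.fintype_prod (f := fun j (s : ℝ) => Real.exp (-a j * s ^ 2))
    fun j => integrable_exp_neg_mul_sq (ha j)

lemma integral_exp_neg_sum_sq (a : Fin d → ℝ) :
    ∫ t : Fin d → ℝ, Real.exp (-∑ j, a j * t j ^ 2) = ∏ j, Real.sqrt (Real.pi / a j) := by
  have e : ∀ t : Fin d → ℝ, Real.exp (-∑ j, a j * t j ^ 2) = ∏ j, Real.exp (-a j * t j ^ 2) := by
    intro t
    rw [← Real.exp_sum, ← Finset.sum_neg_distrib]; simp
  simp_rw [e]
  rw [integral_fintype_prod_volume_eq_prod (f := fun j (s : ℝ) => Real.exp (-a j * s ^ 2))]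
  simp_rw [integral_gaussian]

/-- Uniform bound on the multinomial weights, of the order of the local limit theorem. -/
lemma exists_multinomialWeight_le {x : Fin d → ℝ} (hx : ∀ i, 0 < x i) (hx1 : l1Norm x < 1) :
    ∃ C, ∀ r : ℕ, 0 < r → ∀ k ∈ multiIndices d r,
      multinomialWeight k r x * Real.sqrt r ^ d ≤ C := by
  set a : Fin d → ℝ := fun j => 4 * (1 - l1Norm x) * x j / Real.pi ^ 2 with ha
  have hx0 : 0 < 1 - l1Norm x := by linarith
  have hpi := Real.pi_pos
  have ha0 : ∀ j, 0 < a j := fun j => by have := hx j; positivity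
  -- The halved rates `a j / 2` appear because inversion involves the modulus of the characteristic
  -- function, not its square.
  refine ⟨((2 * Real.pi) ^ d)⁻¹ * ∏ j, Real.sqrt (Real.pi / (a j / 2)), fun r hr k hk => ?_⟩
  have hr' : (0 : ℝ) < r := by exact_mod_cast hr
  have h1 := multinomialWeight_le_integral x hk
  have hb0 : ∀ j, 0 < r * (a j / 2) := fun j => by have := ha0 j; positivity
  have h2 : ∫ t in torusBox d, ‖stepCharFun x t‖ ^ r ≤
      ∫ t : Fin d → ℝ, Real.exp (-∑ j, r * (a j / 2) * t j ^ 2) := by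
    refine le_trans (setIntegral_mono_on ?_ (integrable_exp_neg_sum_sq hb0).integrableOn
      measurableSet_torusBox ?_) (setIntegral_le_integral (integrable_exp_neg_sum_sq hb0)
        (Eventually.of_forall fun t => (Real.exp_pos _).le))
    · have := (integrable_torusBox (d := d) ((continuous_stepCharFun x).pow r)).norm
      simpa [norm_pow, IntegrableOn] using this
    · intro t ht
      have h := normSq_stepCharFun_le (fun i => (hx i).le) hx1.le ht
      rw [Complex.normSq_eq_norm_sq] at h
      have h' : ‖stepCharFun x t‖ ≤ Real.exp (-∑ j, a j / 2 * t j ^ 2) := by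
        refine le_of_sq_le_sq ?_ (Real.exp_pos _).le
        rw [← Real.exp_nat_mul]
        refine h.trans (le_of_eq ?_)
        congr 1
        rw [mul_neg, Finset.mul_sum]
        congr 1
        exact Finset.sum_congr rfl fun j _ => by simp only [ha]; push_cast; ring
      calc _ ≤ Real.exp (-∑ j, a j / 2 * t j ^ 2) ^ r := pow_le_pow_left₀ (norm_nonneg _) h' r
        _ = _ := by
          rw [← Real.exp_nat_mul, mul_neg, Finset.mul_sum]
          congr 2
          exact Finset.sum_congr rfl fun j _ => by ring
  have h3 : ∏ j, Real.sqrt (Real.pi / (r * (a j / 2))) =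
      (Real.sqrt r ^ d)⁻¹ * ∏ j, Real.sqrt (Real.pi / (a j / 2)) := by
    have : ∀ j, Real.sqrt (Real.pi / (r * (a j / 2))) =
        (Real.sqrt r)⁻¹ * Real.sqrt (Real.pi / (a j / 2)) := by
      intro j
      rw [← Real.sqrt_inv, ← Real.sqrt_mul (by positivity)]
      congr 1
      have := (ha0 j).ne'
      field_simp
    simp_rw [this, Finset.prod_mul_distrib]
    simp
  rw [integral_exp_neg_sum_sq, h3] at h2
  have h4 := h1.trans h2
  have hs : 0 < Real.sqrt r ^ d := pow_pos (Real.sqrt_pos.2 hr') d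
  rw [← le_div_iff₀ hs, ← mul_le_mul_iff_right₀ (show 0 < (2 * Real.pi) ^ d by positivity)]
  refine h4.trans (le_of_eq ?_)
  field_simp

end Fourier

/-! ### Gaussian limit of the collision probability -/

section LocalLimit

variable {d : ℕ}

/-- The covariance form of one step of the multinomial walk. -/
def covForm (x t : Fin d → ℝ) : ℝ := ∑ j, x j * t j ^ 2 - (∑ j, x j * t j) ^ 2

/-- Cauchy–Schwarz with weights `x j`, whose total is `l1Norm x`. It makes the form coercive in the
interior of the simplex, hence the Gaussian integrable. -/
lemma le_covForm {x : Fin d → ℝ} (hx : ∀ i, 0 ≤ x i) (t : Fin d → ℝ) :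
    ∑ j, (1 - l1Norm x) * x j * t j ^ 2 ≤ covForm x t := by
  have h : (∑ j, x j * t j) ^ 2 ≤ (∑ j, x j) * ∑ j, x j * t j ^ 2 :=
    Finset.sum_sq_le_sum_mul_sum_of_sq_le_mul _ (fun j _ => hx j)
      (fun j _ => mul_nonneg (hx j) (sq_nonneg _)) fun j _ => le_of_eq (by ring)
  unfold covForm
  rw [l1Norm_eq_sum hx]
  simp_rw [mul_assoc]
  rw [← Finset.mul_sum]
  linarith

lemma continuous_covForm (x : Fin d → ℝ) : Continuous (covForm x) := by
  unfold covForm; fun_prop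

lemma integrable_exp_neg_covForm {x : Fin d → ℝ} (hx : ∀ i, 0 < x i) (hx1 : l1Norm x < 1) :
    Integrable fun t => Real.exp (-covForm x t) := by
  refine (integrable_exp_neg_sum_sq (a := fun j => (1 - l1Norm x) * x j)
    fun j => mul_pos (by linarith) (hx j)).mono'
    (Real.continuous_exp.comp (continuous_covForm x).neg).aestronglyMeasurable
    (Eventually.of_forall fun t => ?_)
  rw [Real.norm_eq_abs, Real.abs_exp]
  exact Real.exp_le_exp.2 (neg_le_neg (le_covForm (fun i => (hx i).le) t))

lemma integrable_exp_neg_sub_sq (u c : ℝ) : Integrable fun s : ℝ => Real.exp (-(s - u) ^ 2 + c) := by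
  have := ((integrable_exp_neg_mul_sq (b := 1) one_pos).comp_sub_right u).mul_const (Real.exp c)
  simpa [Real.exp_add] using this

lemma integral_exp_neg_sub_sq (u c : ℝ) :
    ∫ s : ℝ, Real.exp (-(s - u) ^ 2 + c) = Real.sqrt Real.pi * Real.exp c := by
  simp_rw [Real.exp_add]
  rw [integral_mul_const, integral_sub_right_eq_self (fun s : ℝ => Real.exp (-s ^ 2)) u]
  have := integral_gaussian 1
  simp only [neg_mul, one_mul, div_one] at this
  rw [this]

/-- The Gaussian integral for the covariance form, by linearizing the squared linear term. -/
lemma integral_exp_neg_covForm {x : Fin d → ℝ} (hx : ∀ i, 0 < x i) (hx1 : l1Norm x < 1) :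
    ∫ t, Real.exp (-covForm x t) =
      (∏ j, Real.sqrt (Real.pi / x j)) * Real.sqrt (1 / (1 - l1Norm x)) := by
  have hpi := Real.pi_pos
  have hx0 : 0 < 1 - l1Norm x := by linarith
  -- Auxiliary variable `s`: integrating it out returns `√π * exp (-covForm x t)`. Expanding the
  -- square cancels the squared linear term of `covForm`, and the exponent becomes `-∑ x j (t j -
  -- s)² - (1 - l1Norm x) s²`, which factorizes after a translation in `t`.
  set F : (Fin d → ℝ) → ℝ → ℝ := fun t s =>
    Real.exp (-(s - ∑ j, x j * t j) ^ 2 + -covForm x t) with hF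
  have hFc : Continuous (Function.uncurry F) := by
    have := continuous_covForm x
    simp only [hF, Function.uncurry_def]; fun_prop
  have hFi : Integrable (Function.uncurry F) (volume.prod volume) := by
    rw [integrable_prod_iff hFc.aestronglyMeasurable]
    have hFt : ∀ t, Integrable (F t) := fun t =>
      integrable_exp_neg_sub_sq (∑ j, x j * t j) (-covForm x t)
    refine ⟨Eventually.of_forall hFt, ?_⟩
    have : ∀ t, ∫ s, ‖Function.uncurry F (t, s)‖ = Real.sqrt Real.pi * Real.exp (-covForm x t) := by
      intro t
      rw [← integral_exp_neg_sub_sq (∑ j, x j * t j)]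
      refine integral_congr_ae (Eventually.of_forall fun s => ?_)
      simp [hF, Function.uncurry]
    simp_rw [this]
    exact (integrable_exp_neg_covForm hx hx1).const_mul _
  have hswap := integral_integral_swap hFi
  have hleft : ∫ t, ∫ s, F t s = Real.sqrt Real.pi * ∫ t, Real.exp (-covForm x t) := by
    simp only [hF, integral_exp_neg_sub_sq, integral_const_mul]
  have hinner : ∀ s : ℝ, ∫ t, F t s =
      (∏ j, Real.sqrt (Real.pi / x j)) * Real.exp (-(1 - l1Norm x) * s ^ 2) := by
    intro s
    have e : ∀ t : Fin d → ℝ, F t s =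
        Real.exp (-(1 - l1Norm x) * s ^ 2) * Real.exp (-∑ j, x j * (t - fun _ => s : Fin d → ℝ) j ^ 2) := by
      intro t
      rw [← Real.exp_add]
      simp only [hF, covForm, Pi.sub_apply]
      congr 1
      have : ∑ j, x j * (t j - s) ^ 2 =
          ∑ j, x j * t j ^ 2 - 2 * s * ∑ j, x j * t j + (∑ j, x j) * s ^ 2 := by
        rw [Finset.mul_sum, ← Finset.sum_sub_distrib, Finset.sum_mul, ← Finset.sum_add_distrib]
        exact Finset.sum_congr rfl fun j _ => by ring
      rw [this, l1Norm_eq_sum fun i => (hx i).le]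
      ring
    simp_rw [e]
    rw [integral_const_mul, integral_sub_right_eq_self
      (fun t : Fin d → ℝ => Real.exp (-∑ j, x j * t j ^ 2)), integral_exp_neg_sum_sq]
    ring
  rw [hleft] at hswap
  simp_rw [hinner] at hswap
  rw [integral_const_mul, integral_gaussian, show Real.pi / (1 - l1Norm x) =
    Real.pi * (1 / (1 - l1Norm x)) by ring, Real.sqrt_mul hpi.le] at hswap
  refine mul_left_cancel₀ (Real.sqrt_pos.2 hpi).ne' ?_
  rw [hswap]; ring

lemma psi_eq {x : Fin d → ℝ} (hx : ∀ i, 0 < x i) (hx1 : l1Norm x < 1) :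
    psi x = ((2 * Real.pi) ^ d)⁻¹ * ((∏ j, Real.sqrt (Real.pi / x j)) *
      Real.sqrt (1 / (1 - l1Norm x))) := by
  have hpi := Real.pi_pos
  have hx0 : 0 < 1 - l1Norm x := by linarith
  have hp : 0 < ∏ i, x i := Finset.prod_pos fun i _ => hx i
  unfold psi
  rw [Real.rpow_neg (by positivity), ← Real.sqrt_eq_rpow, ← Real.sqrt_inv]
  refine (Real.sqrt_eq_iff_mul_self_eq (by positivity) (by positivity)).2 ?_
  have h1 : (∏ j, Real.sqrt (Real.pi / x j)) ^ 2 = Real.pi ^ d / ∏ j, x j := by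
    rw [← Finset.prod_pow, Finset.prod_congr rfl fun j _ => Real.sq_sqrt (div_pos hpi (hx j)).le,
      Finset.prod_div_distrib]
    simp
  have h2 : Real.sqrt (1 / (1 - l1Norm x)) ^ 2 = 1 / (1 - l1Norm x) := Real.sq_sqrt (by positivity)
  have h4 : (4 : ℝ) ^ d = (2 ^ d) ^ 2 := by rw [← pow_mul, mul_comm, pow_mul]; norm_num
  rw [← sq, mul_pow _ _ 2, mul_pow _ (Real.sqrt _) 2, h1, h2, mul_pow 4 Real.pi, mul_pow 2 Real.pi,
    h4]
  field_simp

lemma psi_pos {x : Fin d → ℝ} (hx : ∀ i, 0 < x i) (hx1 : l1Norm x < 1) : 0 < psi x := by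
  have hpi := Real.pi_pos
  have hx0 : 0 < 1 - l1Norm x := by linarith
  have hp : 0 < ∏ i, x i := Finset.prod_pos fun i _ => hx i
  exact Real.rpow_pos_of_pos (by positivity) _

lemma tendsto_sqrt_mul_sin (a : ℝ) :
    Tendsto (fun r : ℕ => Real.sqrt r * Real.sin ((Real.sqrt r)⁻¹ * a)) atTop (𝓝 a) := by
  have h : HasDerivAt (fun h : ℝ => Real.sin (h * a)) a 0 := by
    have := ((hasDerivAt_id (0 : ℝ)).mul_const a).sin
    simpa using this
  have h' := hasDerivAt_iff_tendsto_slope_zero.1 h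
  have hs : Tendsto (fun r : ℕ => (Real.sqrt r)⁻¹) atTop (𝓝[≠] 0) := by
    refine tendsto_nhdsWithin_iff.2 ⟨tendsto_inv_atTop_zero.comp
      (Real.tendsto_sqrt_atTop.comp tendsto_natCast_atTop_atTop), ?_⟩
    filter_upwards [eventually_gt_atTop 0] with r hr
    have : (0 : ℝ) < r := by exact_mod_cast hr
    exact (inv_pos.2 (Real.sqrt_pos.2 this)).ne'
  refine (h'.comp hs).congr fun r => ?_
  simp

lemma tendsto_mul_one_sub_cos (a : ℝ) :
    Tendsto (fun r : ℕ => r * (1 - Real.cos ((Real.sqrt r)⁻¹ * a))) atTop (𝓝 (a ^ 2 / 2)) := by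
  have h := ((tendsto_sqrt_mul_sin (a / 2)).pow 2).const_mul 2
  rw [show 2 * (a / 2) ^ 2 = a ^ 2 / 2 by ring] at h
  refine h.congr fun r => ?_
  have e : (Real.sqrt r)⁻¹ * a = 2 * ((Real.sqrt r)⁻¹ * (a / 2)) := by ring
  rw [e, Real.cos_two_mul, Real.cos_sq', mul_pow, Real.sq_sqrt (Nat.cast_nonneg r)]
  ring

/-- The squared modulus is `(1 - q)² + w²` with `r q → ∑ x j t j² / 2` and `√r w → ∑ x j t j`. So
`r` times its distance to 1 tends to `-covForm x t`, and the power tends to the exponential. -/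
lemma tendsto_normSq_stepCharFun_pow {x : Fin d → ℝ} (t : Fin d → ℝ) (hx : ∀ i, 0 ≤ x i) :
    Tendsto (fun r : ℕ => Complex.normSq (stepCharFun x ((Real.sqrt r)⁻¹ • t)) ^ r) atTop
      (𝓝 (Real.exp (-covForm x t))) := by
  set q : ℕ → ℝ := fun r => ∑ j, x j * (1 - Real.cos ((Real.sqrt r)⁻¹ * t j)) with hq
  set w : ℕ → ℝ := fun r => ∑ j, x j * Real.sin ((Real.sqrt r)⁻¹ * t j) with hw
  have hrq : Tendsto (fun r : ℕ => r * q r) atTop (𝓝 (∑ j, x j * (t j ^ 2 / 2))) := by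
    have := tendsto_finsetSum Finset.univ fun j _ =>
      (tendsto_mul_one_sub_cos (t j)).const_mul (x j)
    refine this.congr fun r => ?_
    simp only [hq, Finset.mul_sum]
    exact Finset.sum_congr rfl fun j _ => by ring
  have hsw : Tendsto (fun r : ℕ => Real.sqrt r * w r) atTop (𝓝 (∑ j, x j * t j)) := by
    have := tendsto_finsetSum Finset.univ fun j _ => (tendsto_sqrt_mul_sin (t j)).const_mul (x j)
    refine this.congr fun r => ?_
    simp only [hw, Finset.mul_sum]
    exact Finset.sum_congr rfl fun j _ => by ring
  have hq0 : Tendsto q atTop (𝓝 0) := by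
    have := hrq.mul (tendsto_inv_atTop_zero.comp (tendsto_natCast_atTop_atTop (R := ℝ)))
    rw [mul_zero] at this
    refine this.congr' ?_
    filter_upwards [eventually_gt_atTop 0] with r hr
    have : (r : ℝ) ≠ 0 := by exact_mod_cast hr.ne'
    simp only [Function.comp_apply]; field_simp
  have hlim : Tendsto (fun r : ℕ => (r : ℝ) *
      (Complex.normSq (stepCharFun x ((Real.sqrt r)⁻¹ • t)) - 1)) atTop (𝓝 (-covForm x t)) := by
    have h := ((hrq.const_mul (-2)).add (hrq.mul hq0)).add (hsw.pow 2)
    have e : -2 * ∑ j, x j * (t j ^ 2 / 2) + (∑ j, x j * (t j ^ 2 / 2)) * 0 +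
        (∑ j, x j * t j) ^ 2 = -covForm x t := by
      rw [covForm, show ∑ j, x j * (t j ^ 2 / 2) = (∑ j, x j * t j ^ 2) / 2 by
        rw [Finset.sum_div]; exact Finset.sum_congr rfl fun j _ => by ring]
      ring
    rw [e] at h
    refine h.congr fun r => ?_
    have e2 : 1 - l1Norm x + ∑ j, x j * Real.cos ((Real.sqrt r)⁻¹ * t j) = 1 - q r := by
      simp only [hq, mul_sub, mul_one, Finset.sum_sub_distrib, l1Norm_eq_sum hx]; ring
    rw [normSq_stepCharFun]
    simp only [Pi.smul_apply, smul_eq_mul]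
    rw [e2, mul_pow, Real.sq_sqrt (Nat.cast_nonneg r)]
    ring
  refine (Real.tendsto_one_add_pow_exp_of_tendsto hlim).congr fun r => ?_
  congr 1; ring

/-- The collision probability of two independent multinomial vectors. -/
theorem tendsto_sum_multinomialWeight_sq {x : Fin d → ℝ} (hx : ∀ i, 0 < x i)
    (hx1 : l1Norm x < 1) :
    Tendsto (fun r : ℕ => Real.sqrt r ^ d * ∑ k ∈ multiIndices d r, multinomialWeight k r x ^ 2)
      atTop (𝓝 (psi x)) := by
  have hpi := Real.pi_pos
  have hx0 : 0 < 1 - l1Norm x := by linarith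
  set a : Fin d → ℝ := fun j => 4 * (1 - l1Norm x) * x j / Real.pi ^ 2 with ha
  have ha0 : ∀ j, 0 < a j := fun j => by have := hx j; positivity
  set F : ℕ → (Fin d → ℝ) → ℝ := fun r =>
    (torusBox d).indicator fun t => Complex.normSq (stepCharFun x t) ^ r with hF
  have hFm : ∀ r, Measurable (F r) := fun r =>
    (((Complex.continuous_normSq.comp (continuous_stepCharFun x)).pow r).measurable).indicator
      measurableSet_torusBox
  have hmain : Tendsto (fun r : ℕ => ∫ t, F r ((Real.sqrt r)⁻¹ • t)) atTop
      (𝓝 (∫ t, Real.exp (-covForm x t))) := by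
    -- The torus estimate is quadratic in `t`, so rescaling by `√r` and raising to the power `r`
    -- give the same Gaussian majorant for all `r > 0`.
    refine tendsto_integral_filter_of_dominated_convergence
      (fun t => Real.exp (-∑ j, a j * t j ^ 2)) (Eventually.of_forall fun r =>
        ((hFm r).comp (measurable_const_smul _)).aestronglyMeasurable) ?_
      (integrable_exp_neg_sum_sq ha0) ?_
    · filter_upwards [eventually_gt_atTop 0] with r hr
      refine Eventually.of_forall fun t => ?_
      have hr' : (0 : ℝ) < r := by exact_mod_cast hr
      by_cases ht : (Real.sqrt r)⁻¹ • t ∈ torusBox d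
      · simp only [hF, Set.indicator_of_mem ht]
        rw [Real.norm_of_nonneg (pow_nonneg (Complex.normSq_nonneg _) _)]
        refine (pow_le_pow_left₀ (Complex.normSq_nonneg _)
          (normSq_stepCharFun_le (fun i => (hx i).le) hx1.le ht) r).trans (le_of_eq ?_)
        rw [← Real.exp_nat_mul, mul_neg, Finset.mul_sum]
        congr 2
        refine Finset.sum_congr rfl fun j _ => ?_
        simp only [Pi.smul_apply, smul_eq_mul, ha, mul_pow, inv_pow, Real.sq_sqrt hr'.le]
        field_simp
      · simp only [hF, Set.indicator_of_notMem ht, norm_zero]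
        positivity
    · refine Eventually.of_forall fun t => ?_
      refine (tendsto_normSq_stepCharFun_pow t fun i => (hx i).le).congr' ?_
      have hs : ∀ j, Tendsto (fun r : ℕ => (Real.sqrt r)⁻¹ * t j) atTop (𝓝 0) := fun j => by
        have := (tendsto_inv_atTop_zero.comp
          (Real.tendsto_sqrt_atTop.comp (tendsto_natCast_atTop_atTop (R := ℝ)))).mul_const (t j)
        simpa using this
      have : ∀ᶠ r : ℕ in atTop, ∀ j, (Real.sqrt r)⁻¹ * t j ∈ Set.Ioc (-Real.pi) Real.pi :=
        eventually_all.2 fun j => (hs j).eventually_mem (Ioc_mem_nhds (by linarith) hpi)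
      filter_upwards [this] with r hr
      have ht : (Real.sqrt r)⁻¹ • t ∈ torusBox d := fun j _ => hr j
      simp only [hF, Set.indicator_of_mem ht]
  rw [integral_exp_neg_covForm hx hx1] at hmain
  have h := hmain.const_mul ((2 * Real.pi) ^ d)⁻¹
  rw [← psi_eq hx hx1] at h
  refine h.congr fun r => ?_
  -- The Jacobian of the rescaling is the factor `√r ^ d` of the statement.
  rw [Measure.integral_comp_inv_smul_of_nonneg volume (F r) (Real.sqrt_nonneg _),
    integral_indicator measurableSet_torusBox, ← sum_multinomialWeight_sq]
  simp only [Module.finrank_fin_fun, smul_eq_mul]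
  field_simp

end LocalLimit

/-! ### Cubes of the grid and averages over them -/

section Cubes

variable {d : ℕ}

/-- The lower corner `k / m` of a cube. -/
noncomputable def gridPoint (k : Fin d → ℕ) (m : ℕ) : Fin d → ℝ := fun i => (k i : ℝ) / m

lemma cube_eq_pi (k : Fin d → ℕ) (m : ℕ) :
    cube k m = Set.univ.pi fun i => Set.Ioc (gridPoint k m i) (((k i : ℝ) + 1) / m) := by
  ext y; simp [cube, gridPoint, Set.mem_pi]

lemma measurableSet_cube (k : Fin d → ℕ) (m : ℕ) : MeasurableSet (cube k m) := by
  rw [cube_eq_pi]; exact MeasurableSet.univ_pi fun _ => measurableSet_Ioc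

lemma volume_cube (k : Fin d → ℕ) (m : ℕ) :
    volume (cube k m) = ENNReal.ofReal ((m : ℝ)⁻¹ ^ d) := by
  rw [cube_eq_pi, volume_pi_pi]
  have : ∀ i, volume (Set.Ioc (gridPoint k m i) (((k i : ℝ) + 1) / m)) =
      ENNReal.ofReal ((m : ℝ)⁻¹) := fun i => by
    rw [Real.volume_Ioc, gridPoint]; congr 1; ring
  simp_rw [this, Finset.prod_const, Finset.card_univ, Fintype.card_fin]
  rw [ENNReal.ofReal_pow (by positivity)]

lemma volume_real_cube (k : Fin d → ℕ) (m : ℕ) :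
    (volume : Measure (Fin d → ℝ)).real (cube k m) = (m : ℝ)⁻¹ ^ d := by
  rw [measureReal_def, volume_cube, ENNReal.toReal_ofReal (by positivity)]

lemma volume_cube_lt_top (k : Fin d → ℕ) (m : ℕ) : volume (cube k m) < ⊤ := by
  rw [volume_cube]; exact ENNReal.ofReal_lt_top

lemma norm_sub_gridPoint_le {k : Fin d → ℕ} {m : ℕ} {y : Fin d → ℝ} (hy : y ∈ cube k m) :
    ‖y - gridPoint k m‖ ≤ (m : ℝ)⁻¹ := by
  refine (pi_norm_le_iff_of_nonneg (by positivity)).2 fun i => ?_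
  have h := hy i
  rw [Pi.sub_apply, gridPoint, Real.norm_eq_abs, abs_of_nonneg (by linarith [h.1])]
  have : ((k i : ℝ) + 1) / m = k i / m + (m : ℝ)⁻¹ := by ring
  linarith [h.2]

lemma eq_of_mem_cube {k l : Fin d → ℕ} {m : ℕ} {y : Fin d → ℝ} (hk : y ∈ cube k m)
    (hl : y ∈ cube l m) : k = l := by
  have key : ∀ {k l : Fin d → ℕ}, y ∈ cube k m → y ∈ cube l m → ∀ i, k i ≤ l i := by
    intro k l hk hl i
    have h := (hk i).1.trans_le (hl i).2
    rcases Nat.eq_zero_or_pos m with rfl | hm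
    · simp at h
    have hm' : (0 : ℝ) < m := by exact_mod_cast hm
    rw [div_lt_div_iff_of_pos_right hm'] at h
    exact Nat.lt_succ_iff.1 (by exact_mod_cast h)
  exact funext fun i => le_antisymm (key hk hl i) (key hl hk i)

/-- The mean of a coordinate over a cube. -/
lemma setIntegral_cube_coord (k : Fin d → ℕ) {m : ℕ} (hm : 0 < m) (i : Fin d) :
    (m : ℝ) ^ d * ∫ y in cube k m, (y i - gridPoint k m i) = (2 * m : ℝ)⁻¹ := by
  have hm' : (0 : ℝ) < m := by exact_mod_cast hm
  have hle : ∀ j, gridPoint k m j ≤ ((k j : ℝ) + 1) / m := fun j => by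
    unfold gridPoint; gcongr; linarith
  -- The coordinate is written as a product over all coordinates so that the integral factorizes.
  have e : ∀ y : Fin d → ℝ, y i - gridPoint k m i =
      ∏ j, if j = i then y j - gridPoint k m j else 1 := by
    intro y; simp
  simp_rw [e]
  rw [cube_eq_pi, volume_pi, Measure.restrict_pi_pi, integral_fintype_prod_eq_prod
    (f := fun j (s : ℝ) => if j = i then s - gridPoint k m j else 1)]
  have h1 : ∀ j, ∫ s in Set.Ioc (gridPoint k m j) (((k j : ℝ) + 1) / m),
      (if j = i then s - gridPoint k m j else 1) =
      (m : ℝ)⁻¹ * if j = i then (2 * m : ℝ)⁻¹ else 1 := by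
    intro j
    rw [← intervalIntegral.integral_of_le (hle j)]
    split_ifs
    · rw [intervalIntegral.integral_comp_sub_right (fun s => s), integral_id]
      unfold gridPoint; field_simp; ring
    · rw [intervalIntegral.integral_const]
      unfold gridPoint; simp; field_simp; ring
  simp_rw [h1, Finset.prod_mul_distrib]
  simp only [Finset.prod_const, Finset.card_univ, Fintype.card_fin, Finset.prod_ite_eq',
    Finset.mem_univ, if_true]
  rw [← mul_assoc, ← mul_pow, mul_inv_cancel₀ hm'.ne', one_pow, one_mul]

/-- The average of a function over a cube. -/
noncomputable def cubeAverage (f : (Fin d → ℝ) → ℝ) (k : Fin d → ℕ) (m : ℕ) : ℝ :=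
  (m : ℝ) ^ d * ∫ y in cube k m, f y

lemma abs_cubeAverage_le {f : (Fin d → ℝ) → ℝ} {k : Fin d → ℕ} {m : ℕ} (hm : 0 < m) {C : ℝ}
    (h : ∀ y ∈ cube k m, |f y| ≤ C) : |cubeAverage f k m| ≤ C := by
  have hm' : (0 : ℝ) < m := by exact_mod_cast hm
  have := norm_setIntegral_le_of_norm_le_const (f := f) (volume_cube_lt_top k m) h
  rw [volume_real_cube, Real.norm_eq_abs] at this
  rw [cubeAverage, abs_mul, abs_of_pos (by positivity)]
  calc _ ≤ (m : ℝ) ^ d * (C * (m : ℝ)⁻¹ ^ d) := by gcongr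
    _ = C := by rw [mul_left_comm, ← mul_pow, mul_inv_cancel₀ hm'.ne', one_pow, mul_one]

lemma cubeAverage_const {m : ℕ} (hm : 0 < m) (k : Fin d → ℕ) (c : ℝ) :
    cubeAverage (fun _ => c) k m = c := by
  have hm' : (0 : ℝ) < m := by exact_mod_cast hm
  rw [cubeAverage, setIntegral_const, volume_real_cube, smul_eq_mul, ← mul_assoc, ← mul_pow,
    mul_inv_cancel₀ hm'.ne', one_pow, one_mul]

lemma cubeAverage_add {f g : (Fin d → ℝ) → ℝ} {k : Fin d → ℕ} {m : ℕ}
    (hf : IntegrableOn f (cube k m)) (hg : IntegrableOn g (cube k m)) :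
    cubeAverage (fun y => f y + g y) k m = cubeAverage f k m + cubeAverage g k m := by
  rw [cubeAverage, integral_add hf hg, mul_add]; rfl

lemma abs_cubeAverage_sub_le {f : (Fin d → ℝ) → ℝ} {k : Fin d → ℕ} {m : ℕ} (hm : 0 < m) {C c : ℝ}
    (hf : IntegrableOn f (cube k m)) (h : ∀ y ∈ cube k m, |f y - c| ≤ C) :
    |cubeAverage f k m - c| ≤ C := by
  have hc : IntegrableOn (fun _ : Fin d → ℝ => -c) (cube k m) :=
    integrableOn_const (volume_cube_lt_top k m).ne
  have := cubeAverage_add hf hc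
  rw [cubeAverage_const hm] at this
  rw [sub_eq_add_neg, ← this]
  exact abs_cubeAverage_le hm h

lemma integrableOn_cube_of_continuous {g : (Fin d → ℝ) → ℝ} (hg : Continuous g) (k : Fin d → ℕ)
    (m : ℕ) : IntegrableOn g (cube k m) := by
  have hK : IsCompact (Set.univ.pi fun i : Fin d =>
      Set.Icc (gridPoint k m i) (((k i : ℝ) + 1) / m)) := isCompact_univ_pi fun _ => isCompact_Icc
  rw [cube_eq_pi]
  exact (hg.continuousOn.integrableOn_compact hK).mono_set
    (Set.pi_mono fun _ _ => Set.Ioc_subset_Icc_self)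

end Cubes

/-! ### Moments of the rescaled multinomial vector about `x` -/

section Moments

variable {d : ℕ} {x : Fin d → ℝ}

lemma coord_le_one (hx : ∀ i, 0 ≤ x i) (hx1 : l1Norm x ≤ 1) (i : Fin d) : x i ≤ 1 := by
  rw [l1Norm_eq_sum hx] at hx1
  exact (Finset.single_le_sum (fun j _ => hx j) (Finset.mem_univ i)).trans hx1

/-- There are `m - 1` trials but the scale is `m`; the mismatch is the extra `-x i`, the source of
the drift `-x i / m` in the bias. -/
lemma gridPoint_sub_coord (x : Fin d → ℝ) (k : Fin d → ℕ) {m : ℕ} (hm : 0 < m) (i : Fin d) :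
    (gridPoint k m - x) i = (m : ℝ)⁻¹ * ((k i - ((m - 1 : ℕ) : ℝ) * x i) - x i) := by
  have hm' : (m : ℝ) ≠ 0 := by exact_mod_cast hm.ne'
  rw [Nat.cast_sub hm, Pi.sub_apply, gridPoint]
  push_cast; field_simp; ring

/-- The mean of the rescaled multinomial vector. -/
lemma sum_multinomialWeight_gridPoint_sub (hx : ∀ i, 0 ≤ x i) {m : ℕ} (hm : 0 < m) (i : Fin d) :
    ∑ k ∈ multiIndices d (m - 1), multinomialWeight k (m - 1) x * (gridPoint k m - x) i =
      -((m : ℝ)⁻¹ * x i) := by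
  have e : ∀ k : Fin d → ℕ, multinomialWeight k (m - 1) x * (gridPoint k m - x) i =
      (m : ℝ)⁻¹ * (multinomialWeight k (m - 1) x * k i) -
      multinomialWeight k (m - 1) x * ((m : ℝ)⁻¹ * (((m - 1 : ℕ) : ℝ) * x i + x i)) := by
    intro k; rw [gridPoint_sub_coord x k hm]; ring
  simp_rw [e, Finset.sum_sub_distrib, ← Finset.mul_sum, ← Finset.sum_mul,
    sum_multinomialWeight_mul_coord hx, sum_multinomialWeight hx]
  ring

/-- The second moments of the rescaled multinomial vector about `x`. -/
lemma sum_multinomialWeight_gridPoint_sub_mul (hx : ∀ i, 0 ≤ x i) {m : ℕ} (hm : 0 < m)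
    (i j : Fin d) :
    ∑ k ∈ multiIndices d (m - 1), multinomialWeight k (m - 1) x *
        ((gridPoint k m - x) i * (gridPoint k m - x) j) =
      (m : ℝ)⁻¹ ^ 2 * (((m - 1 : ℕ) : ℝ) * (x i * (if i = j then 1 else 0) - x i * x j) +
        x i * x j) := by
  set r : ℕ := m - 1
  have e : ∀ k : Fin d → ℕ, multinomialWeight k r x *
        ((gridPoint k m - x) i * (gridPoint k m - x) j) =
      (m : ℝ)⁻¹ ^ 2 * (multinomialWeight k r x * ((k i - r * x i) * (k j - r * x j)) -
      multinomialWeight k r x * k i * x j - multinomialWeight k r x * k j * x i +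
      multinomialWeight k r x * (2 * r * x i * x j + x i * x j)) := by
    intro k; rw [gridPoint_sub_coord x k hm, gridPoint_sub_coord x k hm]; ring
  simp_rw [e, ← Finset.mul_sum, Finset.sum_add_distrib, Finset.sum_sub_distrib, ← Finset.sum_mul,
    sum_multinomialWeight_cov hx, sum_multinomialWeight_mul_coord hx, sum_multinomialWeight hx]
  ring

lemma norm_pow_le_sum (v : Fin d → ℝ) {p : ℕ} (hp : p ≠ 0) : ‖v‖ ^ p ≤ ∑ i, |v i| ^ p := by
  rcases isEmpty_or_nonempty (Fin d) with h | h
  · have : v = 0 := Subsingleton.elim _ _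
    simp [this, hp]
  · obtain ⟨i, hi⟩ := Finite.exists_max fun i => |v i|
    have hv : ‖v‖ ≤ |v i| := (pi_norm_le_iff_of_nonneg (abs_nonneg _)).2 hi
    exact (pow_le_pow_left₀ (norm_nonneg _) hv p).trans
      (Finset.single_le_sum (fun j _ => pow_nonneg (abs_nonneg (v j)) p) (Finset.mem_univ i))

/-- The mean square deviation of the rescaled multinomial vector is of order `1 / m`. -/
lemma sum_multinomialWeight_norm_sq_le (hx : ∀ i, 0 ≤ x i) (hx1 : l1Norm x ≤ 1) {m : ℕ}
    (hm : 0 < m) :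
    ∑ k ∈ multiIndices d (m - 1), multinomialWeight k (m - 1) x * ‖gridPoint k m - x‖ ^ 2 ≤
      d * (m : ℝ)⁻¹ := by
  have hm' : (1 : ℝ) ≤ m := by exact_mod_cast hm
  have hcast : ((m - 1 : ℕ) : ℝ) = m - 1 := by rw [Nat.cast_sub hm]; simp
  calc _ ≤ ∑ k ∈ multiIndices d (m - 1), ∑ i, multinomialWeight k (m - 1) x *
        ((gridPoint k m - x) i * (gridPoint k m - x) i) := by
        refine Finset.sum_le_sum fun k _ => ?_
        rw [← Finset.mul_sum]
        refine mul_le_mul_of_nonneg_left ?_ (multinomialWeight_nonneg hx hx1 _ _)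
        refine (norm_pow_le_sum _ two_ne_zero).trans (le_of_eq ?_)
        exact Finset.sum_congr rfl fun i _ => by rw [sq_abs, sq]
    _ = ∑ i, (m : ℝ)⁻¹ ^ 2 * (((m - 1 : ℕ) : ℝ) * (x i - x i * x i) + x i * x i) := by
        rw [Finset.sum_comm]
        refine Finset.sum_congr rfl fun i _ => ?_
        rw [sum_multinomialWeight_gridPoint_sub_mul hx hm]; simp
    _ ≤ ∑ i : Fin d, (m : ℝ)⁻¹ := by
        refine Finset.sum_le_sum fun i _ => ?_
        have h0 := hx i
        have h1 := coord_le_one hx hx1 i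
        have : (((m - 1 : ℕ) : ℝ) * (x i - x i * x i) + x i * x i) ≤ m := by
          rw [hcast]; nlinarith [mul_nonneg h0 h0]
        calc _ ≤ (m : ℝ)⁻¹ ^ 2 * m := by gcongr
          _ = (m : ℝ)⁻¹ := by field_simp
    _ = _ := by simp

/-- The fourth moment of the deviation of the rescaled multinomial vector is of order `1 / m ^ 2`. -/
lemma sum_multinomialWeight_norm_fourth_le (hx : ∀ i, 0 ≤ x i) (hx1 : l1Norm x ≤ 1) {m : ℕ}
    (hm : 0 < m) :
    ∑ k ∈ multiIndices d (m - 1), multinomialWeight k (m - 1) x * ‖gridPoint k m - x‖ ^ 4 ≤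
      d * (8 * (48 * Real.exp 1 + 1)) * (m : ℝ)⁻¹ ^ 2 := by
  have hm' : (1 : ℝ) ≤ m := by exact_mod_cast hm
  have hcast : ((m - 1 : ℕ) : ℝ) = m - 1 := by rw [Nat.cast_sub hm]; simp
  set r : ℕ := m - 1
  have hrm : (r : ℝ) ≤ m := by rw [hcast]; linarith
  calc _ ≤ ∑ k ∈ multiIndices d r, ∑ i, (m : ℝ)⁻¹ ^ 4 * (8 *
        (multinomialWeight k r x * (k i - r * x i) ^ 4 + multinomialWeight k r x)) := by
        refine Finset.sum_le_sum fun k _ => ?_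
        have hw := multinomialWeight_nonneg hx hx1 k r
        calc _ ≤ multinomialWeight k r x * ∑ i, |(gridPoint k m - x) i| ^ 4 :=
              mul_le_mul_of_nonneg_left (norm_pow_le_sum _ four_ne_zero) hw
          _ ≤ _ := by
              rw [Finset.mul_sum]
              refine Finset.sum_le_sum fun i _ => ?_
              rw [← abs_pow, abs_of_nonneg (by positivity), gridPoint_sub_coord x k hm, mul_pow]
              have h4 : x i ^ 4 ≤ 1 := pow_le_one₀ (hx i) (coord_le_one hx hx1 i)
              have : ((k i - r * x i) - x i) ^ 4 ≤ 8 * ((k i - r * x i) ^ 4 + 1) := by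
                set a := (k i - r * x i : ℝ)
                have : (a - x i) ^ 4 ≤ 8 * (a ^ 4 + x i ^ 4) := by
                  nlinarith [sq_nonneg (a ^ 2 - x i ^ 2), sq_nonneg (a + x i),
                    sq_nonneg ((a + x i) ^ 2), sq_nonneg ((a - x i) * (a + x i)),
                    sq_nonneg (a * x i)]
                linarith
              calc _ ≤ multinomialWeight k r x * ((m : ℝ)⁻¹ ^ 4 *
                    (8 * ((k i - r * x i) ^ 4 + 1))) := by gcongr
                _ = _ := by ring
    _ = ∑ i, (m : ℝ)⁻¹ ^ 4 * (8 *
        (∑ k ∈ multiIndices d r, multinomialWeight k r x * (k i - r * x i) ^ 4 + 1)) := by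
        rw [Finset.sum_comm]
        refine Finset.sum_congr rfl fun i _ => ?_
        rw [← Finset.mul_sum, ← Finset.mul_sum, Finset.sum_add_distrib, sum_multinomialWeight hx]
    _ ≤ ∑ i : Fin d, (8 * (48 * Real.exp 1 + 1)) * (m : ℝ)⁻¹ ^ 2 := by
        refine Finset.sum_le_sum fun i _ => ?_
        have h := sum_multinomialWeight_fourth_le hx hx1 r i
        have h1 : (1 : ℝ) ≤ (m : ℝ) ^ 2 := one_le_pow₀ hm'
        have h2 : 48 * Real.exp 1 * (r : ℝ) ^ 2 ≤ 48 * Real.exp 1 * (m : ℝ) ^ 2 := by gcongr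
        calc _ ≤ (m : ℝ)⁻¹ ^ 4 * (8 * ((48 * Real.exp 1 + 1) * (m : ℝ) ^ 2)) := by
              gcongr; linarith
          _ = _ := by field_simp
    _ = _ := by simp; ring

lemma sum_multinomialWeight_norm_le (hx : ∀ i, 0 ≤ x i) (hx1 : l1Norm x ≤ 1) {m : ℕ}
    (hm : 0 < m) :
    ∑ k ∈ multiIndices d (m - 1), multinomialWeight k (m - 1) x * ‖gridPoint k m - x‖ ≤
      (d + 1) * (Real.sqrt m)⁻¹ := by
  have hm' : (0 : ℝ) < m := by exact_mod_cast hm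
  have hs : 0 < Real.sqrt m := Real.sqrt_pos.2 hm'
  have hss : Real.sqrt m * Real.sqrt m = m := Real.mul_self_sqrt hm'.le
  have h2 := sum_multinomialWeight_norm_sq_le hx hx1 hm
  -- A weighted arithmetic–geometric bound replaces Cauchy–Schwarz for passing from the second
  -- moment to the first.
  have hle : ∀ u : ℝ, u ≤ Real.sqrt m * u ^ 2 + (Real.sqrt m)⁻¹ := by
    intro u
    have : Real.sqrt m * u ^ 2 + (Real.sqrt m)⁻¹ - u =
        (Real.sqrt m)⁻¹ * ((Real.sqrt m * u - 1 / 2) ^ 2 + 3 / 4) := by field_simp; ring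
    have : 0 ≤ (Real.sqrt m)⁻¹ * ((Real.sqrt m * u - 1 / 2) ^ 2 + 3 / 4) := by positivity
    linarith
  calc _ ≤ ∑ k ∈ multiIndices d (m - 1), (Real.sqrt m *
        (multinomialWeight k (m - 1) x * ‖gridPoint k m - x‖ ^ 2) +
        multinomialWeight k (m - 1) x * (Real.sqrt m)⁻¹) :=
        Finset.sum_le_sum fun k _ => (mul_le_mul_of_nonneg_left (hle _)
          (multinomialWeight_nonneg hx hx1 _ _)).trans (le_of_eq (by ring))
    _ ≤ Real.sqrt m * (d * (m : ℝ)⁻¹) + (Real.sqrt m)⁻¹ := by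
        rw [Finset.sum_add_distrib, ← Finset.mul_sum, ← Finset.sum_mul, sum_multinomialWeight hx,
          one_mul]
        gcongr
    _ = _ := by
        have : (m : ℝ)⁻¹ = (Real.sqrt m)⁻¹ * (Real.sqrt m)⁻¹ := by rw [← mul_inv, hss]
        rw [this]; field_simp

end Moments

/-! ### Topology of the simplex and global bounds on the density -/

section Simplex

variable {d : ℕ}

lemma continuous_l1Norm : Continuous (l1Norm : (Fin d → ℝ) → ℝ) := by
  unfold l1Norm; fun_prop

lemma isCompact_simplex : IsCompact (simplex d) := by
  have hc : IsClosed (simplex d) := by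
    have h1 : IsClosed {y : Fin d → ℝ | ∀ i, 0 ≤ y i ∧ y i ≤ 1} := by
      simp only [Set.ofPred_forall]
      exact isClosed_iInter fun i => (isClosed_le continuous_const (continuous_apply i)).inter
        (isClosed_le (continuous_apply i) continuous_const)
    exact h1.inter (isClosed_le continuous_l1Norm continuous_const)
  refine (isCompact_Icc (a := (0 : Fin d → ℝ)) (b := 1)).of_isClosed_subset hc fun y hy => ?_
  exact ⟨fun i => (hy.1 i).1, fun i => (hy.1 i).2⟩

lemma isOpen_simplexInterior : IsOpen (simplexInterior d) := by
  have h1 : IsOpen {y : Fin d → ℝ | ∀ i, 0 < y i ∧ y i < 1} := by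
    simp only [Set.ofPred_forall]
    exact isOpen_iInter_of_finite fun i => (isOpen_lt continuous_const (continuous_apply i)).inter
      (isOpen_lt (continuous_apply i) continuous_const)
  exact h1.inter (isOpen_lt continuous_l1Norm continuous_const)

lemma simplexInterior_subset : simplexInterior d ⊆ simplex d := fun _ hy =>
  ⟨fun i => ⟨(hy.1 i).1.le, (hy.1 i).2.le⟩, hy.2.le⟩

lemma simplex_mem_nhds {x : Fin d → ℝ} (hx : x ∈ simplexInterior d) : simplex d ∈ 𝓝 x :=
  mem_of_superset (isOpen_simplexInterior.mem_nhds hx) simplexInterior_subset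

lemma measurable_of_continuousOn_simplex {f : (Fin d → ℝ) → ℝ} (hf : ContinuousOn f (simplex d))
    (hs : ∀ y, y ∉ simplex d → f y = 0) : Measurable f := by
  classical
  have h1 : f = Set.piecewise (simplex d) f (fun _ => 0) := by
    ext y
    by_cases hy : y ∈ simplex d
    · simp [hy]
    · simp [hy, hs y hy]
  rw [h1]
  exact hf.measurable_piecewise continuousOn_const isCompact_simplex.isClosed.measurableSet

lemma exists_bound_of_continuousOn_simplex {f : (Fin d → ℝ) → ℝ}
    (hf : ContinuousOn f (simplex d)) (hs : ∀ y, y ∉ simplex d → f y = 0) :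
    ∃ M, ∀ y, |f y| ≤ M := by
  obtain ⟨M, hM⟩ := isCompact_simplex.exists_bound_of_continuousOn hf
  refine ⟨max M 0, fun y => ?_⟩
  by_cases hy : y ∈ simplex d
  · exact (hM y hy).trans (le_max_left _ _)
  · rw [hs y hy, abs_zero]; exact le_max_right _ _

/-- Cubes may stick out of the simplex, where the density can jump to 0, so an estimate valid for
all `y` is required. Near `x` it is local regularity; at distance at least `δ` the bound `2 * M` is
absorbed by `‖y - x‖ / δ`. -/
lemma exists_lipschitz_at {f : (Fin d → ℝ) → ℝ} {x : Fin d → ℝ} {M : ℝ} (hM : ∀ y, |f y| ≤ M)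
    (hO : (fun y => f y - f x) =O[𝓝 x] fun y => y - x) :
    ∃ K, 0 ≤ K ∧ ∀ y, |f y - f x| ≤ K * ‖y - x‖ := by
  obtain ⟨C, hC⟩ := hO.bound
  obtain ⟨δ, hδ, hball⟩ := Metric.eventually_nhds_iff.1 hC
  have hM0 : 0 ≤ M := (abs_nonneg _).trans (hM x)
  refine ⟨max C (2 * M / δ), le_max_of_le_right (by positivity), fun y => ?_⟩
  rcases lt_or_ge (dist y x) δ with h | h
  · exact (hball h).trans (by gcongr; exact le_max_left _ _)
  · rw [dist_eq_norm] at h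
    calc |f y - f x| ≤ |f y| + |f x| := abs_sub _ _
      _ ≤ 2 * M / δ * δ := by rw [div_mul_cancel₀ _ hδ.ne']; linarith [hM y, hM x]
      _ ≤ max C (2 * M / δ) * ‖y - x‖ := by gcongr; exact le_max_right _ _

end Simplex

/-! ### Second-order Taylor expansion -/

section Taylor

/-- Second-order Taylor expansion of a twice continuously differentiable function. -/
lemma exists_taylor_two {E : Type*} [NormedAddCommGroup E] [NormedSpace ℝ E] {f : E → ℝ} {x : E}
    (hf : ContDiffAt ℝ 2 f x) {ε : ℝ} (hε : 0 < ε) :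
    ∃ δ > 0, ∀ y, ‖y - x‖ < δ → |f y - f x - fderiv ℝ f x (y - x) -
      1 / 2 * fderiv ℝ (fderiv ℝ f) x (y - x) (y - x)| ≤ ε * ‖y - x‖ ^ 2 := by
  set Q := fderiv ℝ (fderiv ℝ f) x with hQ
  have hd : HasFDerivAt (fderiv ℝ f) Q x :=
    ((hf.fderiv_right (m := 1) (by norm_num)).differentiableAt one_ne_zero).hasFDerivAt
  have hsymm : ∀ v w, Q v w = Q w v := hf.isSymmSndFDerivAt (by simp)
  have hdiff : ∀ᶠ y in 𝓝 x, DifferentiableAt ℝ f y :=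
    (hf.eventually (by simp)).mono fun y hy => hy.differentiableAt two_ne_zero
  have hlo : ∀ᶠ y in 𝓝 x, ‖fderiv ℝ f y - fderiv ℝ f x - Q (y - x)‖ ≤ ε * ‖y - x‖ :=
    hd.isLittleO.bound hε
  obtain ⟨δ, hδ, hball⟩ := Metric.eventually_nhds_iff.1 (hdiff.and hlo)
  refine ⟨δ, hδ, fun y hy => ?_⟩
  -- Mean value inequality for `f` minus its Taylor polynomial on the ball of radius `‖y - x‖`.
  -- Symmetry of `Q` makes the derivative of `1/2 * Q v v` equal to `Q v`.
  set g : E → ℝ := fun z => f z - fderiv ℝ f x (z - x) - 1 / 2 * Q (z - x) (z - x) with hg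
  have hgd : ∀ z ∈ Metric.closedBall x ‖y - x‖,
      HasFDerivWithinAt g (fderiv ℝ f z - fderiv ℝ f x - Q (z - x))
        (Metric.closedBall x ‖y - x‖) z := by
    intro z hz
    have hz' : dist z x < δ := (Metric.mem_closedBall.1 hz).trans_lt hy
    have hs : HasFDerivAt (fun z : E => z - x) (ContinuousLinearMap.id ℝ E) z :=
      (hasFDerivAt_id z).sub_const x
    have h1 : HasFDerivAt (fun z => fderiv ℝ f x (z - x)) (fderiv ℝ f x) z :=
      (fderiv ℝ f x).hasFDerivAt.comp z hs
    have h2 := ((Q.hasFDerivAt.comp z hs).clm_apply hs).const_mul (1 / 2 : ℝ)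
    refine ((((hball hz').1.hasFDerivAt.sub h1).sub h2).congr_fderiv ?_).hasFDerivWithinAt
    ext v
    simp [hsymm v z, hsymm v x]
    ring
  have hbd : ∀ z ∈ Metric.closedBall x ‖y - x‖,
      ‖fderiv ℝ f z - fderiv ℝ f x - Q (z - x)‖ ≤ ε * ‖y - x‖ := by
    intro z hz
    have hz' : dist z x < δ := (Metric.mem_closedBall.1 hz).trans_lt hy
    refine (hball hz').2.trans ?_
    gcongr
    rw [← dist_eq_norm z x]; exact hz
  have := (convex_closedBall x ‖y - x‖).norm_image_sub_le_of_norm_hasFDerivWithin_le hgd hbd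
    (Metric.mem_closedBall_self (norm_nonneg _)) (y := y) (by simp [dist_eq_norm])
  have e : g y - g x = f y - f x - fderiv ℝ f x (y - x) - 1 / 2 * Q (y - x) (y - x) := by
    simp [hg]; ring
  rw [e, Real.norm_eq_abs] at this
  refine this.trans (le_of_eq (by ring))

/-- Away from `x` the remainder has at most quadratic growth and is absorbed by `C * ‖y - x‖ ^ 4`.
Fourth moments are `O(m ^ (-2))`, so this term disappears after multiplication by `m`, however large
`C` is. -/
lemma exists_taylor_two_global {E : Type*} [NormedAddCommGroup E] [NormedSpace ℝ E] {f : E → ℝ}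
    {x : E} (hf : ContDiffAt ℝ 2 f x) {K : ℝ} (hK : ∀ y, |f y - f x| ≤ K * ‖y - x‖)
    {ε : ℝ} (hε : 0 < ε) :
    ∃ C, 0 ≤ C ∧ ∀ y, |f y - f x - fderiv ℝ f x (y - x) -
      1 / 2 * fderiv ℝ (fderiv ℝ f) x (y - x) (y - x)| ≤ ε * ‖y - x‖ ^ 2 + C * ‖y - x‖ ^ 4 := by
  obtain ⟨δ, hδ, hball⟩ := exists_taylor_two hf hε
  set L := fderiv ℝ f x
  set Q := fderiv ℝ (fderiv ℝ f) x
  set A := |K| + ‖L‖ with hA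
  have hA0 : 0 ≤ A := by positivity
  set C := A / δ ^ 3 + 1 / 2 * ‖Q‖ / δ ^ 2 with hC
  have hC0 : 0 ≤ C := by positivity
  refine ⟨C, hC0, fun y => ?_⟩
  rcases lt_or_ge ‖y - x‖ δ with h | h
  · exact (hball y h).trans (le_add_of_nonneg_right (by positivity))
  · set u := ‖y - x‖ with hu
    have hu0 : 0 ≤ u := norm_nonneg _
    have h1 : |L (y - x)| ≤ ‖L‖ * u := L.le_opNorm _
    have h2 : |Q (y - x) (y - x)| ≤ ‖Q‖ * u ^ 2 := by
      have := Q.le_opNorm₂ (y - x) (y - x)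
      rw [Real.norm_eq_abs] at this
      linarith [this, show ‖Q‖ * u ^ 2 = ‖Q‖ * u * u by ring]
    have h3 : |f y - f x| ≤ |K| * u := (hK y).trans (by gcongr; exact le_abs_self _)
    have h4 : |f y - f x - L (y - x) - 1 / 2 * Q (y - x) (y - x)| ≤ A * u + 1 / 2 * ‖Q‖ * u ^ 2 := by
      have t1 := abs_sub (f y - f x - L (y - x)) (1 / 2 * Q (y - x) (y - x))
      have t2 := abs_sub (f y - f x) (L (y - x))
      rw [abs_mul, abs_of_pos (by norm_num : (0 : ℝ) < 1 / 2)] at t1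
      have : A * u = |K| * u + ‖L‖ * u := by rw [hA]; ring
      linarith
    have h5 : A * u ≤ A / δ ^ 3 * u ^ 4 := by
      have : δ ^ 3 ≤ u ^ 3 := pow_le_pow_left₀ hδ.le h 3
      calc A * u = A / δ ^ 3 * (δ ^ 3 * u) := by field_simp
        _ ≤ A / δ ^ 3 * (u ^ 3 * u) := by gcongr
        _ = _ := by ring
    have h6 : 1 / 2 * ‖Q‖ * u ^ 2 ≤ 1 / 2 * ‖Q‖ / δ ^ 2 * u ^ 4 := by
      have : δ ^ 2 ≤ u ^ 2 := pow_le_pow_left₀ hδ.le h 2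
      calc 1 / 2 * ‖Q‖ * u ^ 2 = 1 / 2 * ‖Q‖ / δ ^ 2 * (δ ^ 2 * u ^ 2) := by field_simp
        _ ≤ 1 / 2 * ‖Q‖ / δ ^ 2 * (u ^ 2 * u ^ 2) := by gcongr
        _ = _ := by ring
    have h7 : 0 ≤ ε * u ^ 2 := by positivity
    have h8 : C * u ^ 4 = A / δ ^ 3 * u ^ 4 + 1 / 2 * ‖Q‖ / δ ^ 2 * u ^ 4 := by rw [hC]; ring
    linarith

end Taylor

/-! ### Partial derivatives at interior points -/

section PartialDeriv

variable {d : ℕ} {f : (Fin d → ℝ) → ℝ} {x : Fin d → ℝ}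

lemma partialDeriv_eq (hx : x ∈ simplexInterior d) (i : Fin d) :
    partialDeriv i f x = fderiv ℝ f x (Pi.single i 1) := by
  rw [partialDeriv, fderivWithin_of_mem_nhds (simplex_mem_nhds hx)]

lemma partialDeriv_partialDeriv_eq (hx : x ∈ simplexInterior d) (hf : ContDiffAt ℝ 2 f x)
    (i j : Fin d) :
    partialDeriv i (partialDeriv j f) x =
      fderiv ℝ (fderiv ℝ f) x (Pi.single i 1) (Pi.single j 1) := by
  have hd : DifferentiableAt ℝ (fderiv ℝ f) x :=
    (hf.fderiv_right (m := 1) (by norm_num)).differentiableAt one_ne_zero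
  have he : partialDeriv j f =ᶠ[𝓝 x] fun y => fderiv ℝ f y (Pi.single j 1) := by
    filter_upwards [isOpen_simplexInterior.mem_nhds hx] with y hy
    exact partialDeriv_eq hy j
  rw [partialDeriv_eq hx, he.fderiv_eq, fderiv_clm_apply hd (differentiableAt_const _)]
  simp

end PartialDeriv

/-! ### Bias of the smoothed density -/

section Bias

variable {d : ℕ} {f : (Fin d → ℝ) → ℝ} {x : Fin d → ℝ}

/-- The multinomial average of the cube averages of `f`: the mean of the estimator with
normalizing factor `m ^ d`. -/
noncomputable def smoothedDensity (f : (Fin d → ℝ) → ℝ) (m : ℕ) (x : Fin d → ℝ) : ℝ :=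
  ∑ k ∈ multiIndices d (m - 1), multinomialWeight k (m - 1) x * cubeAverage f k m

lemma integrableOn_cube_of_bounded (hf : Measurable f) {M : ℝ} (hM : ∀ y, |f y| ≤ M)
    (k : Fin d → ℕ) (m : ℕ) : IntegrableOn f (cube k m) :=
  Measure.integrableOn_of_bounded (volume_cube_lt_top k m).ne hf.aestronglyMeasurable
    (M := M) (Eventually.of_forall hM)

lemma norm_sub_le_of_mem_cube {k : Fin d → ℕ} {m : ℕ} {y : Fin d → ℝ} (hy : y ∈ cube k m) :
    ‖y - x‖ ≤ ‖gridPoint k m - x‖ + (m : ℝ)⁻¹ := by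
  have : y - x = (gridPoint k m - x) + (y - gridPoint k m) := by abel
  rw [this]
  exact (norm_add_le _ _).trans (by gcongr; exact norm_sub_gridPoint_le hy)

lemma inv_natCast_le_inv_sqrt {m : ℕ} (hm : 0 < m) : (m : ℝ)⁻¹ ≤ (Real.sqrt m)⁻¹ := by
  have hm' : (1 : ℝ) ≤ m := by exact_mod_cast hm
  have hs : 0 < Real.sqrt m := Real.sqrt_pos.2 (by linarith)
  refine inv_anti₀ hs ?_
  rw [Real.sqrt_le_left (by linarith)]
  nlinarith

/-- For a density Lipschitz at `x`, the local averages deviate from `f x` by `O (m ^ (-1/2))`. -/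
lemma sum_multinomialWeight_abs_cubeAverage_sub_le (hx : ∀ i, 0 ≤ x i) (hx1 : l1Norm x ≤ 1)
    (hf : Measurable f) {M : ℝ} (hM : ∀ y, |f y| ≤ M) {K : ℝ} (hK0 : 0 ≤ K)
    (hK : ∀ y, |f y - f x| ≤ K * ‖y - x‖) {m : ℕ} (hm : 0 < m) :
    ∑ k ∈ multiIndices d (m - 1), multinomialWeight k (m - 1) x * |cubeAverage f k m - f x| ≤
      K * (d + 2) * (Real.sqrt m)⁻¹ := by
  calc _ ≤ ∑ k ∈ multiIndices d (m - 1), (K * (multinomialWeight k (m - 1) x *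
        ‖gridPoint k m - x‖) + multinomialWeight k (m - 1) x * (K * (m : ℝ)⁻¹)) := by
        refine Finset.sum_le_sum fun k _ => ?_
        have h := abs_cubeAverage_sub_le hm (integrableOn_cube_of_bounded hf hM k m) (c := f x)
          (C := K * (‖gridPoint k m - x‖ + (m : ℝ)⁻¹)) fun y hy => (hK y).trans (by
            gcongr; exact norm_sub_le_of_mem_cube hy)
        exact (mul_le_mul_of_nonneg_left h (multinomialWeight_nonneg hx hx1 _ _)).trans
          (le_of_eq (by ring))
    _ ≤ K * ((d + 1) * (Real.sqrt m)⁻¹) + K * (Real.sqrt m)⁻¹ := by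
        rw [Finset.sum_add_distrib, ← Finset.mul_sum, ← Finset.sum_mul, sum_multinomialWeight hx,
          one_mul]
        have h1 := sum_multinomialWeight_norm_le hx hx1 hm
        have h2 := inv_natCast_le_inv_sqrt hm
        gcongr
    _ = _ := by ring

lemma abs_smoothedDensity_sub_le (hx : ∀ i, 0 ≤ x i) (hx1 : l1Norm x ≤ 1)
    (hf : Measurable f) {M : ℝ} (hM : ∀ y, |f y| ≤ M) {K : ℝ} (hK0 : 0 ≤ K)
    (hK : ∀ y, |f y - f x| ≤ K * ‖y - x‖) {m : ℕ} (hm : 0 < m) :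
    |smoothedDensity f m x - f x| ≤ K * (d + 2) * (Real.sqrt m)⁻¹ := by
  have e : smoothedDensity f m x - f x = ∑ k ∈ multiIndices d (m - 1),
      multinomialWeight k (m - 1) x * (cubeAverage f k m - f x) := by
    simp_rw [mul_sub, Finset.sum_sub_distrib, ← Finset.sum_mul, sum_multinomialWeight hx, one_mul]
    rfl
  rw [e]
  refine (Finset.abs_sum_le_sum_abs _ _).trans (le_trans (le_of_eq ?_)
    (sum_multinomialWeight_abs_cubeAverage_sub_le hx hx1 hf hM hK0 hK hm))
  refine Finset.sum_congr rfl fun k _ => ?_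
  rw [abs_mul, abs_of_nonneg (multinomialWeight_nonneg hx hx1 _ _)]

lemma clm_eq_sum (L : (Fin d → ℝ) →L[ℝ] ℝ) (v : Fin d → ℝ) :
    L v = ∑ i, v i * L (Pi.single i 1) := by
  have := LinearMap.pi_apply_eq_sum_univ (L : (Fin d → ℝ) →ₗ[ℝ] ℝ) v
  simp only [ContinuousLinearMap.coe_coe, smul_eq_mul] at this
  rw [this]
  refine Finset.sum_congr rfl fun i _ => ?_
  congr 2; ext j; simp [Pi.single_apply, eq_comm]

lemma cubeAverage_clm (L : (Fin d → ℝ) →L[ℝ] ℝ) (k : Fin d → ℕ) {m : ℕ} (hm : 0 < m) :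
    cubeAverage (fun y => L (y - gridPoint k m)) k m =
      (2 * m : ℝ)⁻¹ * ∑ i, L (Pi.single i 1) := by
  have hint : ∀ i ∈ Finset.univ, IntegrableOn
      (fun y : Fin d → ℝ => (y - gridPoint k m) i * L (Pi.single i 1)) (cube k m) := fun i _ =>
    integrableOn_cube_of_continuous (by fun_prop) k m
  rw [cubeAverage]
  simp_rw [clm_eq_sum L (_ - _)]
  rw [integral_finsetSum _ hint, Finset.mul_sum, Finset.mul_sum]
  refine Finset.sum_congr rfl fun i _ => ?_
  rw [integral_mul_const, ← mul_assoc]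
  congr 1
  exact setIntegral_cube_coord k hm i

lemma abs_bilin_sub_le (Q : (Fin d → ℝ) →L[ℝ] (Fin d → ℝ) →L[ℝ] ℝ) (a b : Fin d → ℝ) :
    |Q a a - Q b b| ≤ ‖Q‖ * ‖a - b‖ * (‖a‖ + ‖b‖) := by
  have e : Q a a - Q b b = Q (a - b) a + Q b (a - b) := by simp
  have h1 : |Q (a - b) a| ≤ ‖Q‖ * ‖a - b‖ * ‖a‖ := Q.le_opNorm₂ _ _
  have h2 : |Q b (a - b)| ≤ ‖Q‖ * ‖b‖ * ‖a - b‖ := Q.le_opNorm₂ _ _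
  rw [e]
  refine (abs_add_le _ _).trans ?_
  linarith [show ‖Q‖ * ‖a - b‖ * (‖a‖ + ‖b‖) = ‖Q‖ * ‖a - b‖ * ‖a‖ + ‖Q‖ * ‖b‖ * ‖a - b‖ by ring]

/-- The multinomial mean of the second-order Taylor polynomial. -/
lemma sum_multinomialWeight_taylor (hx : ∀ i, 0 ≤ x i) {m : ℕ} (hm : 0 < m)
    (L : (Fin d → ℝ) →L[ℝ] ℝ) (Q : (Fin d → ℝ) →L[ℝ] (Fin d → ℝ) →L[ℝ] ℝ) :
    ∑ k ∈ multiIndices d (m - 1), multinomialWeight k (m - 1) x *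
      (L (gridPoint k m - x) + (2 * m : ℝ)⁻¹ * ∑ i, L (Pi.single i 1) +
        1 / 2 * Q (gridPoint k m - x) (gridPoint k m - x)) =
    (m : ℝ)⁻¹ * (∑ i, (1 / 2 - x i) * L (Pi.single i 1) + 1 / 2 * ∑ i, ∑ j,
      (m : ℝ)⁻¹ * (((m - 1 : ℕ) : ℝ) * (x i * (if i = j then 1 else 0) - x i * x j) + x i * x j) *
        Q (Pi.single i 1) (Pi.single j 1)) := by
  have hQ : ∀ v, Q v v = ∑ i, ∑ j, (v i * v j) * Q (Pi.single i 1) (Pi.single j 1) := by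
    intro v
    have h1 := clm_eq_sum (Q.flip v) v
    simp only [ContinuousLinearMap.flip_apply] at h1
    rw [h1]
    refine Finset.sum_congr rfl fun i _ => ?_
    rw [clm_eq_sum (Q (Pi.single i 1)) v, Finset.mul_sum]
    exact Finset.sum_congr rfl fun j _ => by ring
  have hsL : ∑ k ∈ multiIndices d (m - 1), multinomialWeight k (m - 1) x *
      L (gridPoint k m - x) = -((m : ℝ)⁻¹ * ∑ i, x i * L (Pi.single i 1)) := by
    simp_rw [clm_eq_sum L (_ - x), Finset.mul_sum]
    rw [Finset.sum_comm, ← Finset.sum_neg_distrib]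
    refine Finset.sum_congr rfl fun i _ => ?_
    simp_rw [← mul_assoc]
    rw [← Finset.sum_mul, sum_multinomialWeight_gridPoint_sub hx hm]
    ring
  have hsQ : ∑ k ∈ multiIndices d (m - 1), multinomialWeight k (m - 1) x *
      Q (gridPoint k m - x) (gridPoint k m - x) = (m : ℝ)⁻¹ * ∑ i, ∑ j, (m : ℝ)⁻¹ *
      (((m - 1 : ℕ) : ℝ) * (x i * (if i = j then 1 else 0) - x i * x j) + x i * x j) *
        Q (Pi.single i 1) (Pi.single j 1) := by
    simp_rw [hQ, Finset.mul_sum]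
    rw [Finset.sum_comm]
    refine Finset.sum_congr rfl fun i _ => ?_
    rw [Finset.sum_comm]
    refine Finset.sum_congr rfl fun j _ => ?_
    rw [Finset.sum_congr rfl fun k _ => (mul_assoc (multinomialWeight k (m - 1) x)
      ((gridPoint k m - x) i * (gridPoint k m - x) j) _).symm, ← Finset.sum_mul,
      sum_multinomialWeight_gridPoint_sub_mul hx hm]
    ring
  simp_rw [mul_add (multinomialWeight _ _ _), Finset.sum_add_distrib, mul_left_comm _ (1 / 2 : ℝ)]
  rw [hsL, ← Finset.sum_mul, sum_multinomialWeight hx, ← Finset.mul_sum, hsQ]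
  simp_rw [sub_mul, Finset.sum_sub_distrib, ← Finset.mul_sum]
  rw [mul_inv]
  ring

/-- Second-order bias expansion of the smoothed density. -/
theorem tendsto_mul_smoothedDensity_sub (hx : x ∈ simplexInterior d) (hf : Measurable f)
    {M : ℝ} (hM : ∀ y, |f y| ≤ M) {K : ℝ} (hK : ∀ y, |f y - f x| ≤ K * ‖y - x‖)
    (hf2 : ContDiffAt ℝ 2 f x) :
    Tendsto (fun m : ℕ => m * (smoothedDensity f m x - f x)) atTop (𝓝 (biasTerm f x)) := by
  have hx0 : ∀ i, 0 ≤ x i := fun i => (hx.1 i).1.le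
  have hx1 : l1Norm x ≤ 1 := hx.2.le
  set L := fderiv ℝ f x with hL
  set Q := fderiv ℝ (fderiv ℝ f) x with hQ
  set D : ℕ → ℝ := fun m => ∑ i, (1 / 2 - x i) * L (Pi.single i 1) + 1 / 2 * ∑ i, ∑ j,
      (m : ℝ)⁻¹ * (((m - 1 : ℕ) : ℝ) * (x i * (if i = j then 1 else 0) - x i * x j) + x i * x j) *
        Q (Pi.single i 1) (Pi.single j 1) with hD
  have hinv : Tendsto (fun m : ℕ => (m : ℝ)⁻¹) atTop (𝓝 0) :=
    tendsto_inv_atTop_zero.comp tendsto_natCast_atTop_atTop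
  have hDlim : Tendsto D atTop (𝓝 (biasTerm f x)) := by
    have hb : biasTerm f x = ∑ i, (1 / 2 - x i) * L (Pi.single i 1) + 1 / 2 * ∑ i, ∑ j,
        (x i * (if i = j then 1 else 0) - x i * x j) * Q (Pi.single i 1) (Pi.single j 1) := by
      simp only [biasTerm, partialDeriv_partialDeriv_eq hx hf2, hL, hQ]
      simp only [partialDeriv_eq hx]
    rw [hb]
    refine tendsto_const_nhds.add (Tendsto.const_mul _ (tendsto_finsetSum _ fun i _ =>
      tendsto_finsetSum _ fun j _ => Tendsto.mul_const _ ?_))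
    set c := x i * (if i = j then 1 else 0) - x i * x j
    -- `((m - 1) * c + x i * x j) / m = c + (x i * x j - c) / m`.
    have h := (hinv.mul_const (x i * x j - c)).const_add c
    rw [zero_mul, add_zero] at h
    refine h.congr' ?_
    filter_upwards [eventually_gt_atTop 0] with m hm
    have hm' : (m : ℝ) ≠ 0 := by exact_mod_cast hm.ne'
    rw [Nat.cast_sub hm]; push_cast; field_simp; ring
  -- `D m` is `m` times the exact multinomial mean of the averaged Taylor polynomial. Of the
  -- remainder, only the `ε`-part survives multiplication by `m`; everything else is `O(m ^
  -- (-1/2))`.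
  have hest : ∀ ε > 0, ∃ C : ℝ, ∀ m : ℕ, 0 < m →
      |m * (smoothedDensity f m x - f x) - D m| ≤ 2 * d * ε + C * (Real.sqrt m)⁻¹ := by
    intro ε hε
    obtain ⟨C, hC0, hC⟩ := exists_taylor_two_global hf2 hK hε
    set C4 : ℝ := d * (8 * (48 * Real.exp 1 + 1)) with hC4
    have hC40 : 0 ≤ C4 := by positivity
    refine ⟨2 * ε + C * (8 * C4 + 8) + 1 / 2 * ‖Q‖ * (2 * (d + 1) + 1), fun m hm => ?_⟩
    have hm' : (1 : ℝ) ≤ m := by exact_mod_cast hm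
    have hi : (m : ℝ)⁻¹ ≤ (Real.sqrt m)⁻¹ := inv_natCast_le_inv_sqrt hm
    have hi0 : 0 < (m : ℝ)⁻¹ := by positivity
    have hi1 : (m : ℝ)⁻¹ ≤ 1 := inv_le_one_of_one_le₀ hm'
    set T : (Fin d → ℕ) → ℝ := fun k => L (gridPoint k m - x) +
      (2 * m : ℝ)⁻¹ * ∑ i, L (Pi.single i 1) + 1 / 2 * Q (gridPoint k m - x) (gridPoint k m - x)
      with hT
    have hk : ∀ k : Fin d → ℕ, |cubeAverage f k m - f x - T k| ≤
        ε * (2 * ‖gridPoint k m - x‖ ^ 2 + 2 * (m : ℝ)⁻¹ ^ 2) +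
        C * (8 * ‖gridPoint k m - x‖ ^ 4 + 8 * (m : ℝ)⁻¹ ^ 4) +
        1 / 2 * (‖Q‖ * (m : ℝ)⁻¹ * (2 * ‖gridPoint k m - x‖ + (m : ℝ)⁻¹)) := by
      intro k
      set κ := gridPoint k m with hκ
      -- The linear part of `f` within the cube is averaged exactly, since it contributes to the
      -- bias at order `1 / m`. In the quadratic part, replacing `y` by the corner `κ` costs only a
      -- lower-order error.
      have hi1 : IntegrableOn (fun y => L (y - κ)) (cube k m) :=
        integrableOn_cube_of_continuous (by fun_prop) k m
      have hi2 : IntegrableOn (fun y => f y - L (y - κ)) (cube k m) :=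
        (integrableOn_cube_of_bounded hf hM k m).sub hi1
      have hadd := cubeAverage_add hi1 hi2
      simp only [add_sub_cancel] at hadd
      rw [cubeAverage_clm L k hm] at hadd
      have e : cubeAverage f k m - f x - T k = cubeAverage (fun y => f y - L (y - κ)) k m -
          (f x + L (κ - x) + 1 / 2 * Q (κ - x) (κ - x)) := by
        rw [show cubeAverage f k m = _ from hadd]; simp only [hT]; ring
      rw [e]
      refine abs_cubeAverage_sub_le hm hi2 fun y hy => ?_
      have e2 : f y - L (y - κ) - (f x + L (κ - x) + 1 / 2 * Q (κ - x) (κ - x)) =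
          (f y - f x - L (y - x) - 1 / 2 * Q (y - x) (y - x)) +
          1 / 2 * (Q (y - x) (y - x) - Q (κ - x) (κ - x)) := by
        have : L (y - x) = L (y - κ) + L (κ - x) := by rw [← map_add]; congr 1; abel
        rw [this]; ring
      have h1 := hC y
      have h2 := abs_bilin_sub_le Q (y - x) (κ - x)
      have h3 : ‖y - x‖ ≤ ‖κ - x‖ + (m : ℝ)⁻¹ := norm_sub_le_of_mem_cube hy
      have h4 : ‖(y - x) - (κ - x)‖ ≤ (m : ℝ)⁻¹ := by
        rw [sub_sub_sub_cancel_right]; exact norm_sub_gridPoint_le hy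
      set a := ‖κ - x‖
      set b := (m : ℝ)⁻¹
      have ha : 0 ≤ a := norm_nonneg _
      have h5 : ‖y - x‖ ^ 2 ≤ 2 * a ^ 2 + 2 * b ^ 2 :=
        (pow_le_pow_left₀ (norm_nonneg _) h3 2).trans (by nlinarith [sq_nonneg (a - b)])
      have h6 : ‖y - x‖ ^ 4 ≤ 8 * a ^ 4 + 8 * b ^ 4 := by
        have : (2 * a ^ 2 + 2 * b ^ 2) ^ 2 ≤ 8 * a ^ 4 + 8 * b ^ 4 := by
          nlinarith [sq_nonneg (a ^ 2 - b ^ 2)]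
        calc ‖y - x‖ ^ 4 = (‖y - x‖ ^ 2) ^ 2 := by ring
          _ ≤ (2 * a ^ 2 + 2 * b ^ 2) ^ 2 := pow_le_pow_left₀ (by positivity) h5 2
          _ ≤ _ := this
      have h7 : |Q (y - x) (y - x) - Q (κ - x) (κ - x)| ≤ ‖Q‖ * b * (2 * a + b) := by
        refine h2.trans ?_
        have : ‖y - x‖ + a ≤ 2 * a + b := by linarith
        gcongr
      rw [e2]
      refine (abs_add_le _ _).trans (add_le_add (h1.trans ?_) ?_)
      · gcongr
      · rw [abs_mul, abs_of_pos (by norm_num : (0 : ℝ) < 1 / 2)]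
        gcongr
    have hsum : m * (smoothedDensity f m x - f x) - D m =
        m * ∑ k ∈ multiIndices d (m - 1), multinomialWeight k (m - 1) x *
          (cubeAverage f k m - f x - T k) := by
      have hTs := sum_multinomialWeight_taylor hx0 hm L Q
      have hm0 : (m : ℝ) ≠ 0 := by positivity
      simp_rw [mul_sub (multinomialWeight _ _ _), Finset.sum_sub_distrib]
      rw [show ∑ k ∈ multiIndices d (m - 1), multinomialWeight k (m - 1) x * T k = (m : ℝ)⁻¹ * D m
        from hTs, ← Finset.sum_mul, sum_multinomialWeight hx0, one_mul,
        mul_sub (m : ℝ) (_ - f x), mul_inv_cancel_left₀ hm0]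
      rfl
    have hmain : ∑ k ∈ multiIndices d (m - 1), multinomialWeight k (m - 1) x *
          |cubeAverage f k m - f x - T k| ≤
        ε * (2 * (d * (m : ℝ)⁻¹) + 2 * (m : ℝ)⁻¹ ^ 2) +
        C * (8 * (C4 * (m : ℝ)⁻¹ ^ 2) + 8 * (m : ℝ)⁻¹ ^ 4) +
        1 / 2 * (‖Q‖ * (m : ℝ)⁻¹ * (2 * ((d + 1) * (Real.sqrt m)⁻¹) + (m : ℝ)⁻¹)) := by
      set w : (Fin d → ℕ) → ℝ := fun k => multinomialWeight k (m - 1) x with hw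
      set u : (Fin d → ℕ) → ℝ := fun k => ‖gridPoint k m - x‖ with hu
      have s0 : ∑ k ∈ multiIndices d (m - 1), w k = 1 := sum_multinomialWeight hx0 _
      have s1 : ∑ k ∈ multiIndices d (m - 1), w k * u k ≤ _ :=
        sum_multinomialWeight_norm_le hx0 hx1 hm
      have s2 : ∑ k ∈ multiIndices d (m - 1), w k * u k ^ 2 ≤ _ :=
        sum_multinomialWeight_norm_sq_le hx0 hx1 hm
      have s4 : ∑ k ∈ multiIndices d (m - 1), w k * u k ^ 4 ≤ _ :=
        sum_multinomialWeight_norm_fourth_le hx0 hx1 hm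
      set b := (m : ℝ)⁻¹
      calc _ ≤ ∑ k ∈ multiIndices d (m - 1), w k * (ε * (2 * u k ^ 2 + 2 * b ^ 2) +
            C * (8 * u k ^ 4 + 8 * b ^ 4) + 1 / 2 * (‖Q‖ * b * (2 * u k + b))) :=
            Finset.sum_le_sum fun k _ => mul_le_mul_of_nonneg_left (hk k)
              (multinomialWeight_nonneg hx0 hx1 _ _)
        _ = ε * (2 * (∑ k ∈ multiIndices d (m - 1), w k * u k ^ 2) +
              2 * b ^ 2 * ∑ k ∈ multiIndices d (m - 1), w k) +
            C * (8 * (∑ k ∈ multiIndices d (m - 1), w k * u k ^ 4) +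
              8 * b ^ 4 * ∑ k ∈ multiIndices d (m - 1), w k) +
            1 / 2 * (‖Q‖ * b * (2 * (∑ k ∈ multiIndices d (m - 1), w k * u k) +
              b * ∑ k ∈ multiIndices d (m - 1), w k)) := by
            simp only [Finset.mul_sum, ← Finset.sum_add_distrib]
            exact Finset.sum_congr rfl fun k _ => by ring
        _ ≤ _ := by
            rw [s0, mul_one, mul_one, mul_one]
            gcongr
    rw [hsum, abs_mul, abs_of_nonneg (by positivity)]
    have habs : |∑ k ∈ multiIndices d (m - 1), multinomialWeight k (m - 1) x *
        (cubeAverage f k m - f x - T k)| ≤ _ :=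
      (Finset.abs_sum_le_sum_abs _ _).trans (le_trans (le_of_eq (Finset.sum_congr rfl fun k _ => by
        rw [abs_mul, abs_of_nonneg (multinomialWeight_nonneg hx0 hx1 _ _)])) hmain)
    refine (mul_le_mul_of_nonneg_left habs (by positivity)).trans ?_
    set b := (m : ℝ)⁻¹ with hb
    set s := (Real.sqrt m)⁻¹
    have hmb : (m : ℝ) * b = 1 := mul_inv_cancel₀ (by positivity)
    have hb3 : b ^ 3 ≤ b := pow_le_of_le_one hi0.le hi1 (by norm_num)
    have e : (m : ℝ) * (ε * (2 * (d * b) + 2 * b ^ 2) + C * (8 * (C4 * b ^ 2) + 8 * b ^ 4) +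
        1 / 2 * (‖Q‖ * b * (2 * ((d + 1) * s) + b))) =
        2 * d * ε + (2 * ε * b + C * (8 * C4 * b + 8 * b ^ 3) +
          1 / 2 * ‖Q‖ * (2 * (d + 1) * s + b)) := by
      linear_combination (ε * (2 * d + 2 * b) + C * (8 * C4 * b + 8 * b ^ 3) +
        1 / 2 * ‖Q‖ * (2 * ((d + 1) * s) + b)) * hmb
    rw [e]
    calc _ ≤ 2 * d * ε + (2 * ε * s + C * (8 * C4 * s + 8 * s) +
          1 / 2 * ‖Q‖ * (2 * (d + 1) * s + s)) := by
          have := hb3.trans hi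
          gcongr
      _ = _ := by ring
  have hzero : Tendsto (fun m : ℕ => m * (smoothedDensity f m x - f x) - D m) atTop (𝓝 0) := by
    -- The form with strict inequality `m > N` also supplies `m > 0`.
    rw [Metric.tendsto_atTop']
    intro η hη
    -- Chosen so that `2 * d * ε ≤ η / 2`; the `+ 1` avoids division by zero.
    obtain ⟨C, hC⟩ := hest (η / (4 * (d + 1))) (by positivity)
    have hs : Tendsto (fun m : ℕ => C * (Real.sqrt m)⁻¹) atTop (𝓝 0) := by
      have := (tendsto_inv_atTop_zero.comp
        (Real.tendsto_sqrt_atTop.comp (tendsto_natCast_atTop_atTop (R := ℝ)))).const_mul C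
      simpa using this
    have hev : ∀ᶠ m : ℕ in atTop, C * (Real.sqrt m)⁻¹ < η / 2 :=
      hs.eventually_lt_const (by positivity)
    obtain ⟨N, hN⟩ := eventually_atTop.1 hev
    refine ⟨N, fun m hm => ?_⟩
    have h := hC m (by omega)
    have h2 := hN m hm.le
    rw [dist_eq_norm, sub_zero, Real.norm_eq_abs]
    have h3 : 2 * d * (η / (4 * (d + 1))) ≤ η / 2 := by
      rw [mul_div_assoc', div_le_div_iff₀ (by positivity) (by positivity)]
      nlinarith
    linarith
  have := hzero.add hDlim
  simpa using this

end Bias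

/-! ### The estimator as an empirical mean -/

section Kernel

variable {d : ℕ}

/-- The contribution of one observation `y` to the density estimator. -/
noncomputable def estimatorKernel (c : ℝ) (m : ℕ) (x y : Fin d → ℝ) : ℝ :=
  c * ∑ k ∈ multiIndices d (m - 1),
    multinomialWeight k (m - 1) x * (cube k m).indicator (fun _ => (1 : ℝ)) y

lemma densityEstimator_eq {Ω : Type*} (c : ℕ → ℝ) (X : ℕ → Ω → Fin d → ℝ) (n m : ℕ)
    (x : Fin d → ℝ) (ω : Ω) :
    densityEstimator c X n m x ω =
      (n : ℝ)⁻¹ * ∑ i ∈ Finset.range n, estimatorKernel (c m) m x (X i ω) := by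
  simp only [densityEstimator, estimatorKernel, Finset.mul_sum, Finset.sum_mul]
  rw [Finset.sum_comm]
  exact Finset.sum_congr rfl fun i _ => Finset.sum_congr rfl fun k _ => by ring

lemma measurable_estimatorKernel (c : ℝ) (m : ℕ) (x : Fin d → ℝ) :
    Measurable (estimatorKernel c m x) := by
  unfold estimatorKernel
  exact (Finset.measurable_fun_sum _ fun k _ =>
    (measurable_const.indicator (measurableSet_cube k m)).const_mul _).const_mul _

/-- A point lies in at most one cube. The cube is chosen before `g`, so the same `k` serves for the
weights and for their squares. -/
lemma sum_mul_indicator_cube_cases (m : ℕ) (y : Fin d → ℝ) :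
    (∃ k ∈ multiIndices d (m - 1), y ∈ cube k m ∧
      ∀ g : (Fin d → ℕ) → ℝ, ∑ l ∈ multiIndices d (m - 1), g l *
        (cube l m).indicator (fun _ => (1 : ℝ)) y = g k) ∨
    ∀ g : (Fin d → ℕ) → ℝ, ∑ l ∈ multiIndices d (m - 1), g l *
        (cube l m).indicator (fun _ => (1 : ℝ)) y = 0 := by
  by_cases h : ∃ k ∈ multiIndices d (m - 1), y ∈ cube k m
  · obtain ⟨k, hk, hy⟩ := h
    refine Or.inl ⟨k, hk, hy, fun g => ?_⟩
    rw [Finset.sum_eq_single_of_mem k hk]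
    · simp [hy]
    · intro l _ hl
      rw [Set.indicator_of_notMem fun h => hl (eq_of_mem_cube h hy), mul_zero]
  · push Not at h
    refine Or.inr fun g => Finset.sum_eq_zero fun l hl => ?_
    rw [Set.indicator_of_notMem (h l hl), mul_zero]

/-- Disjointness of the cubes removes all cross terms. -/
lemma estimatorKernel_sq (c : ℝ) (m : ℕ) (x y : Fin d → ℝ) :
    estimatorKernel c m x y ^ 2 = c ^ 2 * ∑ k ∈ multiIndices d (m - 1),
      multinomialWeight k (m - 1) x ^ 2 * (cube k m).indicator (fun _ => (1 : ℝ)) y := by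
  rw [estimatorKernel, mul_pow]
  congr 1
  rcases sum_mul_indicator_cube_cases m y with ⟨k, _, _, h⟩ | h
  · rw [h fun k => multinomialWeight k (m - 1) x, h fun k => multinomialWeight k (m - 1) x ^ 2]
  · rw [h fun k => multinomialWeight k (m - 1) x, h fun k => multinomialWeight k (m - 1) x ^ 2]
    simp

lemma abs_estimatorKernel_le {x : Fin d → ℝ} (hx : ∀ i, 0 ≤ x i) (hx1 : l1Norm x ≤ 1) (c : ℝ)
    {m : ℕ} {C : ℝ} (hC0 : 0 ≤ C)
    (hC : ∀ k ∈ multiIndices d (m - 1), multinomialWeight k (m - 1) x ≤ C) (y : Fin d → ℝ) :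
    |estimatorKernel c m x y| ≤ |c| * C := by
  rw [estimatorKernel, abs_mul]
  gcongr
  rcases sum_mul_indicator_cube_cases m y with ⟨k, hk, _, h⟩ | h
  · rw [h fun k => multinomialWeight k (m - 1) x, abs_of_nonneg (multinomialWeight_nonneg hx hx1 _ _)]
    exact hC k hk
  · rw [h fun k => multinomialWeight k (m - 1) x, abs_zero]
    exact hC0

variable {f : (Fin d → ℝ) → ℝ} {ν : Measure (Fin d → ℝ)}

lemma measureReal_cube [IsProbabilityMeasure ν]
    (hν : ν = volume.withDensity fun y => ENNReal.ofReal (f y))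
    (hf0 : ∀ y, 0 ≤ f y) (hf : Measurable f) {M : ℝ} (hM : ∀ y, |f y| ≤ M) {m : ℕ} (hm : 0 < m)
    (k : Fin d → ℕ) : ν.real (cube k m) = ((m : ℝ) ^ d)⁻¹ * cubeAverage f k m := by
  have hm' : (0 : ℝ) < m := by exact_mod_cast hm
  rw [cubeAverage, inv_mul_cancel_left₀ (by positivity), measureReal_def, hν,
    withDensity_apply _ (measurableSet_cube k m),
    ← ofReal_integral_eq_lintegral_ofReal (integrableOn_cube_of_bounded hf hM k m)
      (Eventually.of_forall hf0), ENNReal.toReal_ofReal (integral_nonneg hf0)]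

lemma integral_sum_indicator_cube [IsProbabilityMeasure ν]
    (hν : ν = volume.withDensity fun y => ENNReal.ofReal (f y))
    (hf0 : ∀ y, 0 ≤ f y) (hf : Measurable f) {M : ℝ} (hM : ∀ y, |f y| ≤ M) {m : ℕ} (hm : 0 < m)
    (s : Finset (Fin d → ℕ)) (g : (Fin d → ℕ) → ℝ) :
    ∫ y, ∑ k ∈ s, g k * (cube k m).indicator (fun _ => (1 : ℝ)) y ∂ν =
      ((m : ℝ) ^ d)⁻¹ * ∑ k ∈ s, g k * cubeAverage f k m := by
  rw [integral_finsetSum _ fun k _ =>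
    ((integrable_const (1 : ℝ)).indicator (measurableSet_cube k m)).const_mul _, Finset.mul_sum]
  refine Finset.sum_congr rfl fun k _ => ?_
  rw [integral_const_mul, integral_indicator_const _ (measurableSet_cube k m), smul_eq_mul, mul_one,
    measureReal_cube hν hf0 hf hM hm]
  ring

lemma integral_estimatorKernel [IsProbabilityMeasure ν]
    (hν : ν = volume.withDensity fun y => ENNReal.ofReal (f y))
    (hf0 : ∀ y, 0 ≤ f y) (hf : Measurable f) {M : ℝ} (hM : ∀ y, |f y| ≤ M) {m : ℕ} (hm : 0 < m)
    (c : ℝ) (x : Fin d → ℝ) :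
    ∫ y, estimatorKernel c m x y ∂ν = c / (m : ℝ) ^ d * smoothedDensity f m x := by
  simp only [estimatorKernel]
  rw [integral_const_mul, integral_sum_indicator_cube hν hf0 hf hM hm, smoothedDensity]
  ring

lemma integral_estimatorKernel_sq [IsProbabilityMeasure ν]
    (hν : ν = volume.withDensity fun y => ENNReal.ofReal (f y))
    (hf0 : ∀ y, 0 ≤ f y) (hf : Measurable f) {M : ℝ} (hM : ∀ y, |f y| ≤ M) {m : ℕ} (hm : 0 < m)
    (c : ℝ) (x : Fin d → ℝ) :
    ∫ y, estimatorKernel c m x y ^ 2 ∂ν = (c / (m : ℝ) ^ d) ^ 2 * ((m : ℝ) ^ d *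
      ∑ k ∈ multiIndices d (m - 1), multinomialWeight k (m - 1) x ^ 2 * cubeAverage f k m) := by
  have hm' : (0 : ℝ) < m := by exact_mod_cast hm
  simp only [estimatorKernel_sq]
  rw [integral_const_mul, integral_sum_indicator_cube hν hf0 hf hM hm]
  field_simp

end Kernel

/-! ### Asymptotic variance of one summand -/

section Variance

variable {d : ℕ} {f : (Fin d → ℝ) → ℝ} {x : Fin d → ℝ}

/-- Passage from `r = m - 1` to `m`: for `m ≥ 2` one has `√m ≤ 2 * √(m - 1)`, which costs the factor
`2 ^ d`. -/
lemma exists_multinomialWeight_pred_le (hx : x ∈ simplexInterior d) :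
    ∃ C, 0 ≤ C ∧ ∀ m : ℕ, 2 ≤ m → ∀ k ∈ multiIndices d (m - 1),
      multinomialWeight k (m - 1) x ≤ C * (Real.sqrt m ^ d)⁻¹ := by
  obtain ⟨C, hC⟩ := exists_multinomialWeight_le (fun i => (hx.1 i).1) hx.2
  refine ⟨2 ^ d * max C 0, by positivity, fun m hm k hk => ?_⟩
  have hm' : (2 : ℝ) ≤ m := by exact_mod_cast hm
  have h := hC (m - 1) (by omega) k hk
  have hw := multinomialWeight_nonneg (fun i => (hx.1 i).1.le) hx.2.le k (m - 1)
  have hs : Real.sqrt m ≤ 2 * Real.sqrt ((m - 1 : ℕ) : ℝ) := by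
    rw [Real.sqrt_le_left (by positivity), mul_pow, Real.sq_sqrt (by positivity),
      Nat.cast_sub (by omega)]
    push_cast; linarith
  have hs0 : 0 < Real.sqrt m := Real.sqrt_pos.2 (by linarith)
  rw [← div_eq_mul_inv, le_div_iff₀ (by positivity)]
  calc _ ≤ multinomialWeight k (m - 1) x * (2 * Real.sqrt ((m - 1 : ℕ) : ℝ)) ^ d := by gcongr
    _ = 2 ^ d * (multinomialWeight k (m - 1) x * Real.sqrt ((m - 1 : ℕ) : ℝ) ^ d) := by
        rw [mul_pow]; ring
    _ ≤ _ := by gcongr; exact h.trans (le_max_left _ _)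

lemma tendsto_inv_sqrt_natCast : Tendsto (fun m : ℕ => (Real.sqrt m)⁻¹) atTop (𝓝 0) :=
  tendsto_inv_atTop_zero.comp (Real.tendsto_sqrt_atTop.comp tendsto_natCast_atTop_atTop)

lemma tendsto_sum_multinomialWeight_pred_sq (hx : x ∈ simplexInterior d) :
    Tendsto (fun m : ℕ => Real.sqrt m ^ d *
      ∑ k ∈ multiIndices d (m - 1), multinomialWeight k (m - 1) x ^ 2) atTop (𝓝 (psi x)) := by
  have h := (tendsto_sum_multinomialWeight_sq (fun i => (hx.1 i).1) hx.2).comp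
    (tendsto_sub_atTop_nat 1)
  have hr : Tendsto (fun m : ℕ => (Real.sqrt (m / ((m - 1 : ℕ) : ℝ))) ^ d) atTop (𝓝 1) := by
    have h1 : Tendsto (fun m : ℕ => (m : ℝ) / ((m - 1 : ℕ) : ℝ)) atTop (𝓝 1) := by
      have h2 := (tendsto_inv_atTop_zero.comp
        ((tendsto_natCast_atTop_atTop (R := ℝ)).comp (tendsto_sub_atTop_nat 1))).const_add 1
      rw [add_zero] at h2
      refine h2.congr' ?_
      filter_upwards [eventually_ge_atTop 2] with m hm
      have hm' : (2 : ℝ) ≤ m := by exact_mod_cast hm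
      have : (m : ℝ) - 1 ≠ 0 := by linarith
      simp only [Function.comp_apply]
      rw [Nat.cast_sub (by omega)]
      push_cast; field_simp; ring
    have := ((Real.continuous_sqrt.tendsto 1).comp h1).pow d
    simpa using this
  have := hr.mul h
  rw [one_mul] at this
  refine this.congr' ?_
  filter_upwards [eventually_ge_atTop 2] with m hm
  have hm' : (2 : ℝ) ≤ m := by exact_mod_cast hm
  have hp : (0 : ℝ) < ((m - 1 : ℕ) : ℝ) := by
    have : 0 < m - 1 := by omega
    exact_mod_cast this
  simp only [Function.comp_apply]
  rw [← mul_assoc, ← mul_pow, ← Real.sqrt_mul (by positivity), div_mul_cancel₀ _ hp.ne']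

/-- The squared weights concentrate at `x`: bounding one of the two factors uniformly by `C * m ^
(-d/2)` leaves a multinomial mean of `|cubeAverage f k m - f x|`, which is `O(m ^ (-1/2))`. -/
lemma tendsto_sum_multinomialWeight_sq_mul_cubeAverage (hx : x ∈ simplexInterior d)
    (hf : Measurable f) {M : ℝ} (hM : ∀ y, |f y| ≤ M) {K : ℝ} (hK0 : 0 ≤ K)
    (hK : ∀ y, |f y - f x| ≤ K * ‖y - x‖) :
    Tendsto (fun m : ℕ => Real.sqrt m ^ d * ∑ k ∈ multiIndices d (m - 1),
      multinomialWeight k (m - 1) x ^ 2 * cubeAverage f k m) atTop (𝓝 (psi x * f x)) := by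
  have hx0 : ∀ i, 0 ≤ x i := fun i => (hx.1 i).1.le
  obtain ⟨C, hC0, hC⟩ := exists_multinomialWeight_pred_le hx
  have h1 := (tendsto_sum_multinomialWeight_pred_sq hx).mul_const (f x)
  have h2 : Tendsto (fun m : ℕ => Real.sqrt m ^ d * ∑ k ∈ multiIndices d (m - 1),
      multinomialWeight k (m - 1) x ^ 2 * (cubeAverage f k m - f x)) atTop (𝓝 0) := by
    refine squeeze_zero_norm' ?_ (by
      simpa using tendsto_inv_sqrt_natCast.const_mul (C * (K * (d + 2))))
    filter_upwards [eventually_ge_atTop 2] with m hm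
    have hm' : (2 : ℝ) ≤ m := by exact_mod_cast hm
    have hs0 : 0 < Real.sqrt m ^ d := pow_pos (Real.sqrt_pos.2 (by linarith)) d
    rw [Real.norm_eq_abs, abs_mul, abs_of_pos hs0]
    calc _ ≤ Real.sqrt m ^ d * ∑ k ∈ multiIndices d (m - 1), C * (Real.sqrt m ^ d)⁻¹ *
          (multinomialWeight k (m - 1) x * |cubeAverage f k m - f x|) := by
          gcongr
          refine (Finset.abs_sum_le_sum_abs _ _).trans (Finset.sum_le_sum fun k hk => ?_)
          rw [abs_mul, abs_of_nonneg (sq_nonneg _), sq, mul_assoc]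
          have hw := multinomialWeight_nonneg hx0 hx.2.le k (m - 1)
          have := hC m hm k hk
          gcongr
      _ = C * ∑ k ∈ multiIndices d (m - 1),
          multinomialWeight k (m - 1) x * |cubeAverage f k m - f x| := by
          rw [← Finset.mul_sum]; field_simp
      _ ≤ C * (K * (d + 2) * (Real.sqrt m)⁻¹) := by
          gcongr
          exact sum_multinomialWeight_abs_cubeAverage_sub_le hx0 hx.2.le hf hM hK0 hK (by omega)
      _ = _ := by ring
  have := h2.add h1
  rw [zero_add] at this
  refine this.congr fun m => ?_
  simp_rw [mul_sub, Finset.sum_sub_distrib, ← Finset.sum_mul]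
  ring

/-- The variance of one summand of the estimator. -/
theorem tendsto_variance_estimatorKernel (hd : 1 ≤ d) {ν : Measure (Fin d → ℝ)}
    [IsProbabilityMeasure ν] (hν : ν = volume.withDensity fun y => ENNReal.ofReal (f y))
    (hf0 : ∀ y, 0 ≤ f y) (hx : x ∈ simplexInterior d)
    (hf : Measurable f) {M : ℝ} (hM : ∀ y, |f y| ≤ M) {K : ℝ} (hK0 : 0 ≤ K)
    (hK : ∀ y, |f y - f x| ≤ K * ‖y - x‖) {c : ℕ → ℝ}
    (hc : Tendsto (fun m : ℕ => c m / (m : ℝ) ^ d) atTop (𝓝 1)) :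
    Tendsto (fun m : ℕ => (Real.sqrt m ^ d)⁻¹ * (∫ y, estimatorKernel (c m) m x y ^ 2 ∂ν -
      (∫ y, estimatorKernel (c m) m x y ∂ν) ^ 2)) atTop (𝓝 (psi x * f x)) := by
  have hx0 : ∀ i, 0 ≤ x i := fun i => (hx.1 i).1.le
  have hS : Tendsto (fun m : ℕ => smoothedDensity f m x) atTop (𝓝 (f x)) := by
    refine tendsto_iff_norm_sub_tendsto_zero.2 (squeeze_zero' (Eventually.of_forall fun m =>
      norm_nonneg _) ?_ (by simpa using tendsto_inv_sqrt_natCast.const_mul (K * (d + 2))))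
    filter_upwards [eventually_gt_atTop 0] with m hm
    exact abs_smoothedDensity_sub_le hx0 hx.2.le hf hM hK0 hK hm
  have h1 := (hc.pow 2).mul
    (tendsto_sum_multinomialWeight_sq_mul_cubeAverage hx hf hM hK0 hK)
  -- The squared mean is bounded, and `d ≥ 1` makes its prefactor vanish.
  have h2 := (tendsto_inv_sqrt_natCast.pow d).mul ((hc.mul hS).pow 2)
  rw [zero_pow (by omega), zero_mul] at h2
  have h3 := h1.sub h2
  rw [one_pow, one_mul, sub_zero] at h3
  refine h3.congr' ?_
  filter_upwards [eventually_gt_atTop 0] with m hm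
  have hm' : (0 : ℝ) < m := by exact_mod_cast hm
  have hs0 : 0 < Real.sqrt m ^ d := pow_pos (Real.sqrt_pos.2 hm') d
  have hsq : (m : ℝ) ^ d = Real.sqrt m ^ d * Real.sqrt m ^ d := by
    rw [← mul_pow, Real.mul_self_sqrt hm'.le]
  rw [integral_estimatorKernel_sq hν hf0 hf hM hm, integral_estimatorKernel hν hf0 hf hM hm, mul_sub,
    inv_pow]
  congr 1
  rw [hsq]
  field_simp

end Variance

/-! ### First-order expansion of the normalizing factors -/

section NormalizingFactors

lemma tendsto_mul_cubeFactor_sub_one (d : ℕ) :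
    Tendsto (fun m : ℕ => m * (cubeFactor d m / (m : ℝ) ^ d - 1)) atTop (𝓝 0) := by
  refine tendsto_const_nhds.congr' ?_
  filter_upwards [eventually_gt_atTop 0] with m hm
  have : (m : ℝ) ^ d ≠ 0 := pow_ne_zero _ (by exact_mod_cast hm.ne')
  rw [cubeFactor, div_self this, sub_self, mul_zero]

/-- Raising the dimension from `d` to `d + 1` multiplies the ratio by `1 + d / m`, so the limit
increases by `d`; the total is `0 + 1 + ⋯ + (d - 1)`. -/
lemma tendsto_mul_dirichletFactor_sub_one (d : ℕ) :
    Tendsto (fun m : ℕ => m * (dirichletFactor d m / (m : ℝ) ^ d - 1)) atTop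
      (𝓝 ((d : ℝ) * ((d : ℝ) - 1) / 2)) := by
  induction d with
  | zero =>
    refine Tendsto.congr (f₁ := fun _ : ℕ => (0 : ℝ)) (fun m => ?_) (by simp)
    have : ((m - 1)! : ℝ) ≠ 0 := by positivity
    simp [dirichletFactor, this]
  | succ d ih =>
    have hinv : Tendsto (fun m : ℕ => 1 + d * (m : ℝ)⁻¹) atTop (𝓝 (1 + d * 0)) :=
      ((tendsto_inv_atTop_zero.comp (tendsto_natCast_atTop_atTop (R := ℝ))).const_mul
        (d : ℝ)).const_add 1
    have h := (ih.mul hinv).add_const (d : ℝ)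
    have e : (d : ℝ) * ((d : ℝ) - 1) / 2 * (1 + d * 0) + d =
        ((d + 1 : ℕ) : ℝ) * (((d + 1 : ℕ) : ℝ) - 1) / 2 := by push_cast; ring
    rw [e] at h
    refine h.congr' ?_
    filter_upwards [eventually_gt_atTop 0] with m hm
    have hm' : (m : ℝ) ≠ 0 := by exact_mod_cast hm.ne'
    have h1 : (m - 1 + (d + 1))! = (m + d) * (m - 1 + d)! := by
      rw [← add_assoc, Nat.factorial_succ]; congr 1; omega
    simp only [dirichletFactor]
    rw [h1, pow_succ]
    push_cast
    have : ((m - 1)! : ℝ) ≠ 0 := by positivity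
    field_simp
    ring

lemma tendsto_div_pow_of_tendsto_mul {d : ℕ} {c : ℕ → ℝ} {β : ℝ}
    (hc : Tendsto (fun m : ℕ => m * (c m / (m : ℝ) ^ d - 1)) atTop (𝓝 β)) :
    Tendsto (fun m : ℕ => c m / (m : ℝ) ^ d) atTop (𝓝 1) := by
  have h := ((tendsto_inv_atTop_zero.comp (tendsto_natCast_atTop_atTop (R := ℝ))).mul hc).add_const 1
  rw [zero_mul, zero_add] at h
  refine h.congr' ?_
  filter_upwards [eventually_gt_atTop 0] with m hm
  have hm' : (m : ℝ) ≠ 0 := by exact_mod_cast hm.ne'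
  simp only [Function.comp_apply]
  rw [inv_mul_cancel_left₀ hm']; ring

end NormalizingFactors

/-! ### Asymptotic normality with general scale and centering -/

section Assembly

variable {d : ℕ} {Ω : Type*} [MeasurableSpace Ω] {P : Measure Ω} [IsProbabilityMeasure P]
  {X : ℕ → Ω → Fin d → ℝ} {f : (Fin d → ℝ) → ℝ} {x : Fin d → ℝ}

lemma IsIIDSample.isProbabilityMeasure (hX : IsIIDSample P X f) :
    IsProbabilityMeasure (volume.withDensity fun y => ENNReal.ofReal (f y)) := by
  rw [← hX.law 0]; exact Measure.isProbabilityMeasure_map (hX.measurable 0).aemeasurable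

lemma IsIIDSample.meanEstimator_eq (hX : IsIIDSample P X f) (hf : Measurable f) {M : ℝ}
    (hM : ∀ y, |f y| ≤ M) (c : ℕ → ℝ) {n m : ℕ} (hn : 0 < n) (hm : 0 < m) (x : Fin d → ℝ) :
    meanEstimator P c X n m x = c m / (m : ℝ) ^ d * smoothedDensity f m x := by
  have hn' : (n : ℝ) ≠ 0 := by exact_mod_cast hn.ne'
  have := hX.isProbabilityMeasure
  have hK := measurable_estimatorKernel (c m) m x
  have hint : ∀ i, ∫ ω, estimatorKernel (c m) m x (X i ω) ∂P =
      c m / (m : ℝ) ^ d * smoothedDensity f m x := fun i => by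
    rw [← integral_estimatorKernel rfl hX.nonneg hf hM hm, ← hX.law i,
      integral_map (hX.measurable i).aemeasurable hK.aestronglyMeasurable]
  have hbd : ∃ C, ∀ y, ‖estimatorKernel (c m) m x y‖ ≤ C := by
    refine ⟨|c m| * ∑ k ∈ multiIndices d (m - 1), |multinomialWeight k (m - 1) x|, fun y => ?_⟩
    rw [estimatorKernel, norm_mul]
    refine mul_le_mul_of_nonneg_left ((norm_sum_le _ _).trans (Finset.sum_le_sum fun k _ => ?_))
      (abs_nonneg _)
    rw [norm_mul]
    refine mul_le_of_le_one_right (abs_nonneg _) ?_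
    by_cases h : y ∈ cube k m <;> simp [h]
  obtain ⟨C, hC⟩ := hbd
  rw [meanEstimator]
  simp_rw [densityEstimator_eq]
  have hi : ∀ i, Integrable (fun ω => estimatorKernel (c m) m x (X i ω)) P := fun i =>
    Integrable.of_bound (hK.comp (hX.measurable i)).aestronglyMeasurable C
      (Eventually.of_forall fun ω => hC _)
  rw [integral_const_mul, integral_finsetSum _ fun i _ => hi i]
  simp_rw [hint]
  simp [hn']

/-- Asymptotic normality of the estimator for a general normalization `a n` and centering `s n`. -/
theorem IsIIDSample.convergesToNormal_densityEstimator (hX : IsIIDSample P X f) (hd : 1 ≤ d)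
    (hx : x ∈ simplexInterior d) (hf : Measurable f) {M : ℝ} (hM : ∀ y, |f y| ≤ M) {K : ℝ}
    (hK0 : 0 ≤ K) (hK : ∀ y, |f y - f x| ≤ K * ‖y - x‖) {m : ℕ → ℕ} (hm : Tendsto m atTop atTop)
    {c : ℕ → ℝ} (hc : Tendsto (fun m : ℕ => c m / (m : ℝ) ^ d) atTop (𝓝 1)) {a s : ℕ → ℝ} {τ μ : ℝ}
    (hτ : 0 ≤ τ) (ha : Tendsto (fun n : ℕ => a n ^ 2 * (Real.sqrt (m n) ^ d / n)) atTop (𝓝 τ))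
    (hmn : Tendsto (fun n : ℕ => Real.sqrt (m n) ^ d / n) atTop (𝓝 0))
    (hs : Tendsto (fun n : ℕ => a n * (c (m n) / (m n : ℝ) ^ d * smoothedDensity f (m n) x - s n))
      atTop (𝓝 μ)) :
    ConvergesToNormal P (fun n ω => a n * (densityEstimator c X n (m n) x ω - s n)) μ
      (τ * (psi x * f x)) := by
  have hprob := hX.isProbabilityMeasure
  set ν : Measure (Fin d → ℝ) := volume.withDensity fun y => ENNReal.ofReal (f y) with hν
  have hx0 : ∀ i, 0 ≤ x i := fun i => (hx.1 i).1.le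
  obtain ⟨C, hC0, hC⟩ := exists_multinomialWeight_pred_le hx
  set G : ℕ → (Fin d → ℝ) → ℝ := fun n y => a n / n * estimatorKernel (c (m n)) (m n) x y with hG
  have hY : (fun (n : ℕ) ω => a n * (densityEstimator c X n (m n) x ω - s n)) =
      fun n ω => ∑ i ∈ Finset.range n, G n (X i ω) - a n * s n := by
    ext n ω
    rw [densityEstimator_eq, mul_sub, ← mul_assoc, ← div_eq_mul_inv, Finset.mul_sum]
  have hm0 : ∀ᶠ n in atTop, 2 ≤ m n := hm.eventually_ge_atTop 2
  have hpos : ∀ n, 0 < m n → 0 < Real.sqrt (m n) ^ d := fun n hn =>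
    pow_pos (Real.sqrt_pos.2 (by exact_mod_cast hn)) d
  rw [hY]
  -- The bound `B` combines `|a n| / n` with the kernel bound `|c| * C * m ^ (-d/2)`, rewritten
  -- through `m ^ (-d/2) = m ^ (d/2) / m ^ d` so that the convergent ratio `c / m ^ d` appears.
  refine convergesToNormal_sum_array P hX.measurable hX.indep (ν := ν) hX.law (G := G)
    (fun n => (measurable_estimatorKernel _ _ _).const_mul _)
    (B := fun n => |a n| * (Real.sqrt (m n) ^ d / n) * (|c (m n) / (m n : ℝ) ^ d| * C)) ?_ ?_
    (mul_nonneg hτ (mul_nonneg (psi_pos (fun i => (hx.1 i).1) hx.2).le (hX.nonneg x))) ?_ ?_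
  · filter_upwards [hm0] with n hn y
    have hmn' : (0 : ℝ) < m n := by exact_mod_cast (by omega : 0 < m n)
    have hsp := hpos n (by omega)
    have h := abs_estimatorKernel_le hx0 hx.2.le (c (m n)) (C := C * (Real.sqrt (m n) ^ d)⁻¹)
      (by positivity) (hC (m n) hn) y
    have hsq : (m n : ℝ) ^ d = Real.sqrt (m n) ^ d * Real.sqrt (m n) ^ d := by
      rw [← mul_pow, Real.mul_self_sqrt hmn'.le]
    simp only [hG]
    rw [abs_mul, abs_div, Nat.abs_cast, abs_div (c (m n)), abs_of_pos (pow_pos hmn' d), hsq]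
    calc _ ≤ |a n| / n * (|c (m n)| * (C * (Real.sqrt (m n) ^ d)⁻¹)) := by gcongr
      _ = _ := by field_simp
  -- This is the square root of `(a² * m ^ (d/2) / n) * (m ^ (d/2) / n)`, a convergent factor times
  -- a vanishing one.
  · have h1 : Tendsto (fun n : ℕ => |a n| * (Real.sqrt (m n) ^ d / n)) atTop (𝓝 0) := by
      have h2 := (Real.continuous_sqrt.tendsto _).comp (ha.mul hmn)
      rw [mul_zero, Real.sqrt_zero] at h2
      refine h2.congr fun n => ?_
      simp only [Function.comp_apply]
      rw [mul_assoc, ← sq, ← mul_pow, Real.sqrt_sq_eq_abs, abs_mul,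
        abs_of_nonneg (show 0 ≤ Real.sqrt (m n) ^ d / n by positivity)]
    have h2 := h1.mul (((hc.comp hm).abs).mul_const C)
    rw [zero_mul] at h2
    exact h2
  · have h := ha.mul ((tendsto_variance_estimatorKernel hd hν hX.nonneg hx hf hM hK0 hK hc).comp hm)
    refine h.congr' ?_
    filter_upwards [hm0, eventually_gt_atTop 0] with n hn hn0
    have hn' : (n : ℝ) ≠ 0 := by exact_mod_cast hn0.ne'
    have hsp := (hpos n (by omega)).ne'
    simp only [hG, Function.comp_apply, mul_pow]
    rw [integral_const_mul, integral_const_mul]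
    field_simp
  · refine hs.congr' ?_
    filter_upwards [hm0, eventually_gt_atTop 0] with n hn hn0
    have hn' : (n : ℝ) ≠ 0 := by exact_mod_cast hn0.ne'
    simp only [hG]
    rw [integral_const_mul, integral_estimatorKernel hν hX.nonneg hf hM (by omega)]
    field_simp

/-- Splitting the bias into the smoothing error and the error of the normalizing factor. -/
lemma tendsto_mul_bias {a : ℕ → ℝ} {m : ℕ → ℕ} (hm : Tendsto m atTop atTop) {S c : ℕ → ℝ}
    (hc : Tendsto (fun m : ℕ => c m / (m : ℝ) ^ d) atTop (𝓝 1)) {F μ₁ μ₂ : ℝ}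
    (h1 : Tendsto (fun n => a n * (S (m n) - F)) atTop (𝓝 μ₁))
    (h2 : Tendsto (fun n => a n * (c (m n) / (m n : ℝ) ^ d - 1)) atTop (𝓝 μ₂)) :
    Tendsto (fun n => a n * (c (m n) / (m n : ℝ) ^ d * S (m n) - F)) atTop (𝓝 (μ₁ + μ₂ * F)) := by
  have := ((hc.comp hm).mul h1).add (h2.mul_const F)
  rw [one_mul] at this
  refine this.congr fun n => ?_
  simp only [Function.comp_apply]; ring

lemma sqrt_natCast_pow (m d : ℕ) : Real.sqrt m ^ d = (m : ℝ) ^ ((d : ℝ) / 2) := by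
  rw [Real.sqrt_eq_rpow, ← Real.rpow_natCast, ← Real.rpow_mul (by positivity)]
  congr 1; ring

end Assembly

end BernsteinSimplex

/-! ### The main theorem -/

open BernsteinSimplex in
theorem mainTheorem3 {d : ℕ} (hd : 1 ≤ d) {Ω : Type*} [MeasurableSpace Ω] (P : Measure Ω)
    [IsProbabilityMeasure P] (X : ℕ → Ω → Fin d → ℝ) (f : (Fin d → ℝ) → ℝ)
    (hX : BernsteinSimplex.IsIIDSample P X f)
    (x : Fin d → ℝ) (hx : x ∈ BernsteinSimplex.simplexInterior d) (hfx : 0 < f x)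
    (m : ℕ → ℕ) (hm : Tendsto m atTop atTop) :
    -- `f` Lipschitz on the simplex: both centerings, for both normalizations
    ((∃ K : ℝ≥0, LipschitzOnWith K f (BernsteinSimplex.simplex d)) →
      Tendsto (fun n : ℕ => (n : ℝ) ^ (1 / 2 : ℝ) * (m n : ℝ) ^ (-(d : ℝ) / 4)) atTop atTop →
      ∀ c : ℕ → ℝ, (c = BernsteinSimplex.dirichletFactor d ∨ c = BernsteinSimplex.cubeFactor d) →
        BernsteinSimplex.ConvergesToNormal P
          (fun n ω => (n : ℝ) ^ (1 / 2 : ℝ) * (m n : ℝ) ^ (-(d : ℝ) / 4) *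
            (BernsteinSimplex.densityEstimator c X n (m n) x ω -
              BernsteinSimplex.meanEstimator P c X n (m n) x))
          0 (BernsteinSimplex.psi x * f x) ∧
        (Tendsto (fun n : ℕ => (n : ℝ) ^ (1 / 2 : ℝ) * (m n : ℝ) ^ (-(d : ℝ) / 4 - 1 / 2))
            atTop (𝓝 0) →
          BernsteinSimplex.ConvergesToNormal P
            (fun n ω => (n : ℝ) ^ (1 / 2 : ℝ) * (m n : ℝ) ^ (-(d : ℝ) / 4) *
              (BernsteinSimplex.densityEstimator c X n (m n) x ω - f x))
            0 (BernsteinSimplex.psi x * f x))) ∧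
    -- `f` twice continuously differentiable on the simplex, bandwidth of the critical order
    (ContDiffOn ℝ 2 f (BernsteinSimplex.simplex d) →
      ∀ lam : ℝ, 0 < lam →
      Tendsto (fun n : ℕ => (n : ℝ) ^ (2 / ((d : ℝ) + 4)) * (m n : ℝ)⁻¹) atTop (𝓝 lam) →
        BernsteinSimplex.ConvergesToNormal P
          (fun n ω => (n : ℝ) ^ (2 / ((d : ℝ) + 4)) *
            (BernsteinSimplex.densityEstimator (BernsteinSimplex.cubeFactor d) X n (m n) x ω
              - f x))
          (lam * BernsteinSimplex.biasTerm f x)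
          (lam ^ (-(d : ℝ) / 2) * BernsteinSimplex.psi x * f x) ∧
        BernsteinSimplex.ConvergesToNormal P
          (fun n ω => (n : ℝ) ^ (2 / ((d : ℝ) + 4)) *
            (BernsteinSimplex.densityEstimator (BernsteinSimplex.dirichletFactor d) X n (m n) x ω
              - f x))
          (lam * (BernsteinSimplex.biasTerm f x + (d : ℝ) * ((d : ℝ) - 1) / 2 * f x))
          (lam ^ (-(d : ℝ) / 2) * BernsteinSimplex.psi x * f x)) := by
  have hx0 : ∀ i, 0 ≤ x i := fun i => (hx.1 i).1.le
  have hpos : ∀ᶠ n : ℕ in atTop, (0 : ℝ) < n ∧ (0 : ℝ) < m n := by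
    filter_upwards [eventually_gt_atTop 0, hm.eventually_gt_atTop 0] with n h1 h2
    exact ⟨by exact_mod_cast h1, by exact_mod_cast h2⟩
  refine ⟨?_, ?_⟩
  · rintro ⟨K', hK'⟩ hbase c hc
    have hfc := hK'.continuousOn
    have hf := measurable_of_continuousOn_simplex hfc hX.support
    obtain ⟨M, hM⟩ := exists_bound_of_continuousOn_simplex hfc hX.support
    obtain ⟨K, hK0, hK⟩ := exists_lipschitz_at (x := x) hM (by
      refine Asymptotics.IsBigO.of_bound K' ?_
      filter_upwards [simplex_mem_nhds hx] with y hy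
      exact hK'.norm_sub_le hy (simplexInterior_subset hx))
    -- The two normalizations are treated together: only the existence of a first-order expansion
    -- matters here.
    obtain ⟨β, hβ⟩ : ∃ β, Tendsto (fun m : ℕ => m * (c m / (m : ℝ) ^ d - 1)) atTop (𝓝 β) := by
      rcases hc with rfl | rfl
      · exact ⟨_, tendsto_mul_dirichletFactor_sub_one d⟩
      · exact ⟨_, tendsto_mul_cubeFactor_sub_one d⟩
    have hc1 := tendsto_div_pow_of_tendsto_mul hβ
    set a : ℕ → ℝ := fun n => (n : ℝ) ^ (1 / 2 : ℝ) * (m n : ℝ) ^ (-(d : ℝ) / 4) with ha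
    have hτ1 : ∀ᶠ n : ℕ in atTop, a n ^ 2 * (Real.sqrt (m n) ^ d / n) = 1 := by
      filter_upwards [hpos] with n ⟨hn, hmn⟩
      simp only [ha]
      have h1 : ((n : ℝ) ^ (1 / 2 : ℝ)) ^ 2 = n := by
        rw [← Real.sqrt_eq_rpow, Real.sq_sqrt hn.le]
      have h2 : ((m n : ℝ) ^ (-(d : ℝ) / 4)) ^ 2 * (m n : ℝ) ^ ((d : ℝ) / 2) = 1 := by
        rw [← Real.rpow_natCast, ← Real.rpow_mul hmn.le, ← Real.rpow_add hmn]
        convert Real.rpow_zero _ using 2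
        push_cast; ring
      rw [sqrt_natCast_pow, mul_pow, h1, mul_div_assoc', mul_assoc, h2, mul_one, div_self hn.ne']
    have hτ : Tendsto (fun n : ℕ => a n ^ 2 * (Real.sqrt (m n) ^ d / n)) atTop (𝓝 1) :=
      tendsto_const_nhds.congr' (hτ1.mono fun n h => h.symm)
    -- The quantity is eventually `(a n)⁻¹ ^ 2`, so this is exactly the hypothesis that the scale
    -- diverges.
    have hmn : Tendsto (fun n : ℕ => Real.sqrt (m n) ^ d / n) atTop (𝓝 0) := by
      have h := (tendsto_inv_atTop_zero.comp hbase).pow 2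
      rw [zero_pow two_ne_zero] at h
      refine h.congr' ?_
      filter_upwards [hτ1, hbase.eventually_gt_atTop 0] with n h1 h2
      simp only [Function.comp_apply]
      rw [inv_pow]
      exact (eq_inv_of_mul_eq_one_right h1).symm
    rw [← one_mul (psi x * f x)]
    refine ⟨?_, fun hrate => ?_⟩
    · refine hX.convergesToNormal_densityEstimator hd hx hf hM hK0 hK hm hc1 zero_le_one hτ hmn ?_
      refine tendsto_const_nhds.congr' ?_
      filter_upwards [eventually_gt_atTop 0, hm.eventually_gt_atTop 0] with n h1 h2
      rw [hX.meanEstimator_eq hf hM c h1 h2, sub_self, mul_zero]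
    · refine hX.convergesToNormal_densityEstimator hd hx hf hM hK0 hK hm hc1 zero_le_one hτ hmn ?_
      have hrate' : Tendsto (fun n => a n * (Real.sqrt (m n))⁻¹) atTop (𝓝 0) := by
        refine hrate.congr' ?_
        filter_upwards [hpos] with n ⟨hn, hmn⟩
        rw [Real.rpow_sub hmn, Real.sqrt_eq_rpow]
        simp only [ha]; ring
      have h1 : Tendsto (fun n => a n * (smoothedDensity f (m n) x - f x)) atTop (𝓝 0) := by
        have h := hrate'.abs.mul_const (K * (d + 2))
        rw [abs_zero, zero_mul] at h
        refine squeeze_zero_norm' ?_ h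
        filter_upwards [hm.eventually_gt_atTop 0] with n hn
        rw [norm_mul, abs_mul, abs_of_nonneg (show 0 ≤ (Real.sqrt (m n))⁻¹ by positivity)]
        have := abs_smoothedDensity_sub_le hx0 hx.2.le hf hM hK0 hK hn
        calc _ ≤ |a n| * (K * (d + 2) * (Real.sqrt (m n))⁻¹) := by
              rw [Real.norm_eq_abs, Real.norm_eq_abs]; gcongr
          _ = _ := by ring
      -- The normalization error is `O(1 / m)`; one factor `m ^ (-1/2)` is spent on the rate
      -- condition and the other tends to 0.
      have h2 : Tendsto (fun n => a n * (c (m n) / (m n : ℝ) ^ d - 1)) atTop (𝓝 0) := by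
        have h := (hrate'.mul (tendsto_inv_sqrt_natCast.comp hm)).mul (hβ.comp hm)
        rw [mul_zero, zero_mul] at h
        refine h.congr' ?_
        filter_upwards [hpos] with n ⟨hn, hmn⟩
        have hs : (Real.sqrt (m n))⁻¹ * (Real.sqrt (m n))⁻¹ * (m n : ℝ) = 1 := by
          rw [← mul_inv, Real.mul_self_sqrt hmn.le, inv_mul_cancel₀ hmn.ne']
        simp only [Function.comp_apply]
        linear_combination (a n * (c (m n) / (m n : ℝ) ^ d - 1)) * hs
      have := tendsto_mul_bias (S := fun m => smoothedDensity f m x) hm hc1 h1 h2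
      rwa [zero_mul, add_zero] at this
  · intro hf2 lam hlam hrate
    have hf2x : ContDiffAt ℝ 2 f x := hf2.contDiffAt (simplex_mem_nhds hx)
    have hf := measurable_of_continuousOn_simplex hf2.continuousOn hX.support
    obtain ⟨M, hM⟩ := exists_bound_of_continuousOn_simplex hf2.continuousOn hX.support
    obtain ⟨K, hK0, hK⟩ := exists_lipschitz_at (x := x) hM
      (hf2x.differentiableAt two_ne_zero).isBigO_sub
    set a : ℕ → ℝ := fun n => (n : ℝ) ^ (2 / ((d : ℝ) + 4)) with ha
    have hd4 : (0 : ℝ) < d + 4 := by positivity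
    -- Raise the bandwidth condition to the power `-d/2`; the exponents of `n` agree since `4 / (d +
    -- 4) - 1 = -d / (d + 4)`.
    have hτ : Tendsto (fun n : ℕ => a n ^ 2 * (Real.sqrt (m n) ^ d / n)) atTop
        (𝓝 (lam ^ (-(d : ℝ) / 2))) := by
      have h := ((Real.continuousAt_rpow_const lam (-(d : ℝ) / 2) (Or.inl hlam.ne')).tendsto).comp
        hrate
      refine h.congr' ?_
      filter_upwards [hpos] with n ⟨hn, hmn⟩
      simp only [Function.comp_apply, ha]
      rw [sqrt_natCast_pow, Real.mul_rpow (by positivity) (by positivity), ← Real.rpow_neg_one (m n : ℝ),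
        ← Real.rpow_mul hn.le, ← Real.rpow_mul hmn.le, ← Real.rpow_natCast, ← Real.rpow_mul hn.le,
        div_eq_mul_inv ((m n : ℝ) ^ _) _, mul_comm ((m n : ℝ) ^ _) (n : ℝ)⁻¹, ← mul_assoc,
        ← Real.rpow_neg_one (n : ℝ), ← Real.rpow_add hn]
      congr 2
      · push_cast; field_simp; ring
      · ring
    have hainf : Tendsto a atTop atTop :=
      (tendsto_rpow_atTop (by positivity)).comp tendsto_natCast_atTop_atTop
    have hmn : Tendsto (fun n : ℕ => Real.sqrt (m n) ^ d / n) atTop (𝓝 0) := by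
      have h := ((tendsto_inv_atTop_zero.comp hainf).pow 2).mul hτ
      rw [zero_pow two_ne_zero, zero_mul] at h
      refine h.congr' ?_
      filter_upwards [hainf.eventually_gt_atTop 0] with n hn
      simp only [Function.comp_apply]
      rw [inv_pow, inv_mul_cancel_left₀ (by positivity)]
    -- Both normalizations at once, with `β = 0` for the cube factor and `β = d * (d - 1) / 2` for
    -- the Dirichlet factor. As `a n / m n → lam`, every error of order `1 / m` contributes `lam`
    -- times its coefficient.
    have hbias : ∀ (c : ℕ → ℝ) (β : ℝ),
        Tendsto (fun m : ℕ => m * (c m / (m : ℝ) ^ d - 1)) atTop (𝓝 β) →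
        ConvergesToNormal P (fun n ω => a n * (densityEstimator c X n (m n) x ω - f x))
          (lam * biasTerm f x + lam * β * f x) (lam ^ (-(d : ℝ) / 2) * (psi x * f x)) := by
      intro c β hβ
      have hc1 := tendsto_div_pow_of_tendsto_mul hβ
      have hscale : ∀ {g : ℕ → ℝ} {γ : ℝ}, Tendsto (fun m : ℕ => m * g m) atTop (𝓝 γ) →
          Tendsto (fun n => a n * g (m n)) atTop (𝓝 (lam * γ)) := by
        intro g γ hg
        refine (hrate.mul (hg.comp hm)).congr' ?_
        filter_upwards [hpos] with n ⟨hn, hmn⟩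
        simp only [Function.comp_apply]
        rw [mul_assoc, inv_mul_cancel_left₀ hmn.ne']
      have h1 : Tendsto (fun n => a n * (smoothedDensity f (m n) x - f x)) atTop
          (𝓝 (lam * biasTerm f x)) :=
        hscale (g := fun m => smoothedDensity f m x - f x)
          (tendsto_mul_smoothedDensity_sub hx hf hM hK hf2x)
      have h2 : Tendsto (fun n => a n * (c (m n) / (m n : ℝ) ^ d - 1)) atTop (𝓝 (lam * β)) :=
        hscale (g := fun m => c m / (m : ℝ) ^ d - 1) hβ
      exact hX.convergesToNormal_densityEstimator hd hx hf hM hK0 hK hm hc1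
        (Real.rpow_nonneg hlam.le _) hτ hmn
        (tendsto_mul_bias (S := fun m => smoothedDensity f m x) hm hc1 h1 h2)
    rw [mul_assoc (lam ^ (-(d : ℝ) / 2))]
    refine ⟨?_, ?_⟩
    · simpa using hbias _ _ (tendsto_mul_cubeFactor_sub_one d)
    · have := hbias _ _ (tendsto_mul_dirichletFactor_sub_one d)
      rwa [mul_assoc lam, ← mul_add] at this
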